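/- \textbf{Theorem (Free entropy concentration).} Let $P_A$ be a probability measure on $\mathbb{R}^k$, let $\Delta>0$, and let $f:\mathbb{R}\times\mathbb{R}^k\to\mathbb{R}$ and $\varphi:\mathbb{R}\to\mathbb{R}$ satisfy: (A1) $\varphi\in C^3$ is Lipschitz and odd, and has bounded second and third derivatives; (A2) $f$ is measurable, and for $P_A$-almost every $A$ the function $f(\cdot\,;A)$ is twice differentiable, and it and its first and second derivatives are bounded by a constant that does not depend on $A$. Put $\rho:=\mathbb{E}\,\varphi'(N)$ and $\epsilon:=\mathbb{E}\,\varphi(N)^2-\rho^2$ with $N\sim\mathcal{N}(0,1)$, and $$P_{\rm out}(y\mid x):=\int P_A(dA)\,\frac{1}{\sqrt{2\pi\Delta}}\,e^{-\frac{1}{2\Delta}(y-f(x;A))^2}.$$ For $d,p,n\ge 1$ and $t\in[0,1]$ let $\mathbf a^*\in\mathbb{R}^p$, $\mathbf W^*\in\mathbb{R}^{p\times d}$, $\mathbf v^*\in\mathbb{R}^d$, and for $\mu=1,\dots,n$ let $\xi^*_\mu\in\mathbb{R}$, $\mathbf X_\mu\in\mathbb{R}^d$, $Z_\mu\in\mathbb{R}$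 have i.i.d. $\mathcal{N}(0,1)$ entries and let $A_\mu\sim P_A$, all independent. Set $$S_{t\mu}:=\sqrt{1-t}\,\frac{\mathbf a^{*\intercal}}{\sqrt p}\,\varphi\Big(\frac{\mathbf W^*\mathbf X_\mu}{\sqrt d}\Big)+\sqrt t\,\rho\,\frac{\mathbf v^{*\intercal}\mathbf X_\mu}{\sqrt d}+\sqrt{t\epsilon}\,\xi^*_\mu,\qquad Y_{t\mu}:=f(S_{t\mu};A_\mu)+\sqrt\Delta\,Z_\mu ,$$ where $\varphi$ acts componentwise, let $s_{t\mu}$ be given by the formula for $S_{t\mu}$ with $(\mathbf a^*,\mathbf W^*,\mathbf v^*,\xi^*_\mu)$ replaced by $(\mathbf a,\mathbf W,\mathbf v,\xi_\mu)$, and let $$\mathcal{Z}_t:=\int D\mathbf a\,D\mathbf W\,D\mathbf v\,D\boldsymbol\xi\;\exp\Big(\sum_{\mu=1}^n\log P_{\rm out}(Y_{t\mu}\mid s_{t\mu})\Big),$$ where $D$ denotes integration against i.i.d. standard Gaussian entries. Write $\mathbb{E}_{\setminus\mathbf a^*}$ and $\mathbb{V}_{\setminus\mathbf a^*}$ for expectation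 and variance with respect to $(\mathbf W^*,\mathbf v^*,\boldsymbol\xi^*,\mathbf X,\mathbf A,\mathbf Z)$ at fixed $\mathbf a^*$. Then there is a constant $C\ge 0$, depending only on $\varphi$ and on the channel $(f,P_A,\Delta)$, such that for all $d,p,n\ge1$ and all $t\in[0,1]$ the random variable $\frac1n\log\mathcal{Z}_t$ is square integrable and $$\mathbb{E}_{\mathbf a^*}\mathbb{V}_{\setminus\mathbf a^*}\Big(\frac1n\log\mathcal{Z}_t\Big)=\mathbb{E}\Big(\frac1n\log\mathcal{Z}_t-\mathbb{E}_{\setminus\mathbf a^*}\frac1n\log\mathcal{Z}_t\Big)^2\le C\Big(\frac1d+\frac1n\Big).$$ -/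

import Mathlib

open MeasureTheory ProbabilityTheory
open scoped NNReal

noncomputable section

namespace TwoLayer

/-- Regularity of the activation function. -/
structure ActivationRegular (φ : ℝ → ℝ) : Prop where
  contDiff : ContDiff ℝ 3 φ
  lipschitz : ∃ c : ℝ≥0, LipschitzWith c φ
  odd : Function.Odd φ
  bdd_second : ∃ K : ℝ, ∀ x, |iteratedDeriv 2 φ x| ≤ K
  bdd_third : ∃ K : ℝ, ∀ x, |iteratedDeriv 3 φ x| ≤ K

/-- Regularity of the readout `f (x ; A)`: for `PA`-almost every `A` the function `f (· ; A)` is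
twice differentiable, and it and its first two derivatives in `x` are bounded, by a constant that
does not depend on `A`. -/
structure ReadoutRegular {k : ℕ} (PA : Measure (Fin k → ℝ)) (f : ℝ → (Fin k → ℝ) → ℝ) :
    Prop where
  measurable : Measurable (Function.uncurry f)
  differentiable : ∀ᵐ A ∂PA, Differentiable ℝ (fun x => f x A) ∧
    Differentiable ℝ (deriv (fun x => f x A))
  bdd : ∃ K : ℝ, ∀ᵐ A ∂PA, ∀ x, |f x A| ≤ K ∧ |deriv (fun x => f x A) x| ≤ K ∧
    |deriv (deriv (fun x => f x A)) x| ≤ K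

/-- `ρ = E φ'(N)` for a standard Gaussian variable `N`. -/
def rho (φ : ℝ → ℝ) : ℝ := ∫ x, deriv φ x ∂(gaussianReal 0 1)

/-- `ε = E φ(N)² - ρ²` for a standard Gaussian variable `N`. -/
def eps (φ : ℝ → ℝ) : ℝ := (∫ x, φ x ^ 2 ∂(gaussianReal 0 1)) - rho φ ^ 2

/-- The law of a vector with i.i.d. standard Gaussian entries. -/
def gaussVec (m : ℕ) : Measure (Fin m → ℝ) := Measure.pi fun _ => gaussianReal 0 1

/-- The law of an `m × l` array with i.i.d. standard Gaussian entries. -/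
def gaussMat (m l : ℕ) : Measure (Fin m → Fin l → ℝ) := Measure.pi fun _ => gaussVec l

/-- The output kernel `P_out (y | x)`. -/
def Pout {k : ℕ} (PA : Measure (Fin k → ℝ)) (f : ℝ → (Fin k → ℝ) → ℝ) (Δ y x : ℝ) : ℝ :=
  ∫ A, 1 / √(2 * Real.pi * Δ) * Real.exp (-(1 / (2 * Δ)) * (y - f x A) ^ 2) ∂PA

/-- `u_y (x) = log P_out (y | x)`. -/
def logPout {k : ℕ} (PA : Measure (Fin k → ℝ)) (f : ℝ → (Fin k → ℝ) → ℝ) (Δ y x : ℝ) : ℝ :=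
  Real.log (Pout PA f Δ y x)

/-- The interpolating argument of the channel at one input `x`, for the weights `a, W, v` and the
effective noise `ξ`: evaluated at the teacher's weights this is `S_{tμ}`, at the student's weights
it is `s_{tμ}`. -/
def interpField {d p : ℕ} (φ : ℝ → ℝ) (t : ℝ) (a : Fin p → ℝ) (W : Fin p → Fin d → ℝ)
    (v : Fin d → ℝ) (ξ : ℝ) (x : Fin d → ℝ) : ℝ :=
  √(1 - t) * ((∑ i, a i * φ ((∑ j, W i j * x j) / √d)) / √p)
    + √t * rho φ * ((∑ j, v j * x j) / √d)
    + √(t * eps φ) * ξ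

/-- The parameters `(a, W, v, ξ)` of the interpolating student. -/
abbrev Params (d p n : ℕ) : Type :=
  (Fin p → ℝ) × (Fin p → Fin d → ℝ) × (Fin d → ℝ) × (Fin n → ℝ)

/-- The prior `Da DW Dv Dξ`. -/
def prior (d p n : ℕ) : Measure (Params d p n) :=
  (gaussVec p).prod ((gaussMat p d).prod ((gaussVec d).prod (gaussVec n)))

/-- The partition function `Z_t` of the data set with inputs `X` and responses `Y`. -/
def partitionFn {d n k : ℕ} (p : ℕ) (PA : Measure (Fin k → ℝ)) (f : ℝ → (Fin k → ℝ) → ℝ)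
    (Δ : ℝ) (φ : ℝ → ℝ) (t : ℝ) (X : Fin n → Fin d → ℝ) (Y : Fin n → ℝ) : ℝ :=
  ∫ θ : Params d p n, Real.exp (∑ μ : Fin n,
    logPout PA f Δ (Y μ) (interpField φ t θ.1 θ.2.1 θ.2.2.1 (θ.2.2.2 μ) (X μ))) ∂(prior d p n)

/-- All the quenched disorder except the teacher's readout weights `a*`: the tuple
`(W*, v*, ξ*, X, A, Z)` of the teacher's inner weights, the linear teacher's weights, its effective
noise, the inputs, the randomness of the readout and the label noise. -/
abbrev Disorder (d p n k : ℕ) : Type :=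
  (Fin p → Fin d → ℝ) × (Fin d → ℝ) × (Fin n → ℝ) × (Fin n → Fin d → ℝ) ×
    (Fin n → Fin k → ℝ) × (Fin n → ℝ)

/-- The law of the disorder: all components are independent, the `A_μ` have law `PA`, and all other
entries are standard Gaussian. -/
def disorderLaw {k : ℕ} (d p n : ℕ) (PA : Measure (Fin k → ℝ)) : Measure (Disorder d p n k) :=
  (gaussMat p d).prod ((gaussVec d).prod ((gaussVec n).prod ((gaussMat n d).prod
    ((Measure.pi fun _ : Fin n => PA).prod (gaussVec n)))))

/-- The responses `Y_{tμ} = f (S_{tμ} ; A_μ) + √Δ Z_μ` of the interpolating teacher. -/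
def response {d p n k : ℕ} (f : ℝ → (Fin k → ℝ) → ℝ) (Δ : ℝ) (φ : ℝ → ℝ) (t : ℝ)
    (a : Fin p → ℝ) : Disorder d p n k → Fin n → ℝ :=
  fun (W, v, ξ, X, A, Z) μ => f (interpField φ t a W v (ξ μ) (X μ)) (A μ) + √Δ * Z μ

/-- The free entropy per sample `(1/n) log Z_t`, as a function of `a*` and of the rest of the
disorder. -/
def freeEntropy {d p n k : ℕ} (PA : Measure (Fin k → ℝ)) (f : ℝ → (Fin k → ℝ) → ℝ)
    (Δ : ℝ) (φ : ℝ → ℝ) (t : ℝ) (a : Fin p → ℝ) (ω : Disorder d p n k) : ℝ :=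
  1 / (n : ℝ) * Real.log (partitionFn p PA f Δ φ t ω.2.2.2.1 (response f Δ φ t a ω))

end TwoLayer

end

/-!
Group the disorder into the inner weights `w = (W*, v*)` and the `n` independent samples
`(ξ_μ, X_μ, A_μ, Z_μ)`, and split the variance of `log Z_t` into the mean over `w` of its variance
over the samples and the variance over `w` of its mean over the samples.

Since `f` is bounded, `log P_out` is bounded by a quadratic polynomial in the label noise, uniformly
in the field. Replacing one sample therefore changes `log Z_t` by a square integrable quantity, and
the Efron–Stein inequality bounds the first term by `O(n)`.

The second term is bounded with the Gaussian Poincaré inequality in `w`. In the direction of one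
row of weights, the gradient of the averaged `log Z_t` is a sum over `μ` of the correlations,
divided by `√d`, of a square integrable function with the `d` coordinates of `X_μ`. These
coordinates are orthonormal, so by Bessel's inequality the squared gradient is `O(n ^ 2 / d)` and
not merely `O(n ^ 2)`.

Dividing by `n ^ 2` and averaging over the outer weights, where `E ‖a*‖² / p = 1`, gives
`O(1 / n + 1 / d)`.
-/

noncomputable section

namespace TwoLayer

section Variance

variable {α β : Type*} [MeasurableSpace α] [MeasurableSpace β] {P : Measure α} {Q : Measure β}

lemma sq_integral_le_integral_sq [IsProbabilityMeasure P] {g : α → ℝ} (hg : MemLp g 2 P) :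
    (∫ x, g x ∂P) ^ 2 ≤ ∫ x, g x ^ 2 ∂P := by
  have h := variance_nonneg g P
  rw [variance_eq_sub hg] at h
  simpa using h

lemma integral_add_comp_fst_comp_snd [IsProbabilityMeasure P] {h : α → ℝ} (hh : Integrable h P) :
    ∫ z : α × α, (h z.1 + h z.2) ∂(P.prod P) = 2 * ∫ x, h x ∂P := by
  rw [integral_add (hh.comp_fst P) (hh.comp_snd P), integral_fun_fst, integral_fun_snd,
    probReal_univ, one_smul, two_mul]

lemma two_mul_variance_eq [IsProbabilityMeasure P] {g : α → ℝ} (hg : MemLp g 2 P) :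
    2 * Var[g; P] = ∫ z : α × α, (g z.1 - g z.2) ^ 2 ∂(P.prod P) := by
  have hg₁ : Integrable g P := hg.integrable one_le_two
  calc 2 * Var[g; P] = 2 * ∫ x, g x ^ 2 ∂P - 2 * ((∫ x, g x ∂P) * ∫ x, g x ∂P) := by
        rw [variance_eq_sub hg, sq (∫ x, g x ∂P), mul_sub]; rfl
    _ = ∫ z : α × α, ((g z.1 ^ 2 + g z.2 ^ 2) - 2 * (g z.1 * g z.2)) ∂(P.prod P) := by
        rw [integral_sub ((hg.integrable_sq.comp_fst P).fun_add (hg.integrable_sq.comp_snd P))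
          ((hg₁.mul_prod hg₁).const_mul 2), integral_const_mul, integral_prod_mul,
          integral_add_comp_fst_comp_snd hg.integrable_sq]
    _ = ∫ z : α × α, (g z.1 - g z.2) ^ 2 ∂(P.prod P) := by
        congr with z; ring

lemma variance_le_of_abs_sub_le [IsProbabilityMeasure P] {g b : α → ℝ} (hg : MemLp g 2 P)
    (hb : MemLp b 2 P) (h : ∀ᵐ z ∂(P.prod P), |g z.1 - g z.2| ≤ b z.1 + b z.2) :
    Var[g; P] ≤ 2 * ∫ x, b x ^ 2 ∂P := by
  have key : 2 * Var[g; P] ≤ 2 * (2 * ∫ x, b x ^ 2 ∂P) := by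
    rw [two_mul_variance_eq hg, ← integral_add_comp_fst_comp_snd hb.integrable_sq,
      ← integral_const_mul]
    refine integral_mono_of_nonneg (.of_forall fun z => sq_nonneg _)
      (((hb.integrable_sq.comp_fst P).fun_add (hb.integrable_sq.comp_snd P)).const_mul 2) ?_
    filter_upwards [h] with z hz
    calc (g z.1 - g z.2) ^ 2 = |g z.1 - g z.2| ^ 2 := (sq_abs _).symm
      _ ≤ (b z.1 + b z.2) ^ 2 := by gcongr
      _ ≤ 2 * (b z.1 ^ 2 + b z.2 ^ 2) := add_sq_le
  linarith

lemma memLp_two_section_ae [SFinite P] [SFinite Q] {g : α × β → ℝ} (hg : MemLp g 2 (P.prod Q)) :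
    ∀ᵐ x ∂P, MemLp (fun y => g (x, y)) 2 Q := by
  filter_upwards [hg.integrable_sq.prod_right_ae, hg.aestronglyMeasurable.prodMk_left]
    with x hx hx'
  exact (memLp_two_iff_integrable_sq hx').2 hx

lemma memLp_two_integral_right [SFinite P] [IsProbabilityMeasure Q] {g : α × β → ℝ}
    (hg : MemLp g 2 (P.prod Q)) : MemLp (fun x => ∫ y, g (x, y) ∂Q) 2 P := by
  have hm : AEStronglyMeasurable (fun x => ∫ y, g (x, y) ∂Q) P :=
    hg.aestronglyMeasurable.integral_prod_right'
  refine (memLp_two_iff_integrable_sq hm).2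
    (hg.integrable_sq.integral_prod_left.mono' (hm.pow 2) ?_)
  filter_upwards [memLp_two_section_ae hg] with x hx
  rw [Real.norm_of_nonneg (sq_nonneg _)]
  exact sq_integral_le_integral_sq hx

lemma integral_variance_eq [SFinite P] [IsProbabilityMeasure Q] {g : α × β → ℝ}
    (hg : MemLp g 2 (P.prod Q)) :
    ∫ x, Var[fun y => g (x, y); Q] ∂P
      = ∫ z, g z ^ 2 ∂(P.prod Q) - ∫ x, (∫ y, g (x, y) ∂Q) ^ 2 ∂P := by
  rw [integral_prod _ hg.integrable_sq, ← integral_sub hg.integrable_sq.integral_prod_left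
    (memLp_two_integral_right hg).integrable_sq]
  refine integral_congr_ae ?_
  filter_upwards [memLp_two_section_ae hg] with x hx
  simp only [variance_eq_sub hx, Pi.pow_apply]

lemma integral_variance_eq_integral_sq_sub [SFinite P] [IsProbabilityMeasure Q] {g : α → β → ℝ}
    (hg : MemLp (fun z : α × β => g z.1 z.2) 2 (P.prod Q)) :
    ∫ x, Var[g x; Q] ∂P = ∫ z, (g z.1 z.2 - ∫ y, g z.1 y ∂Q) ^ 2 ∂(P.prod Q) := by
  have hsq : Integrable (fun z => (g z.1 z.2 - ∫ y, g z.1 y ∂Q) ^ 2) (P.prod Q) :=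
    (hg.sub ((memLp_two_integral_right hg).comp_fst Q)).integrable_sq
  rw [integral_prod _ hsq]
  refine integral_congr_ae ?_
  filter_upwards [memLp_two_section_ae hg] with x hx
  exact variance_eq_integral hx.aestronglyMeasurable.aemeasurable

lemma variance_prod_eq [IsProbabilityMeasure P] [IsProbabilityMeasure Q] {g : α × β → ℝ}
    (hg : MemLp g 2 (P.prod Q)) :
    Var[g; P.prod Q] =
      ∫ x, Var[fun y => g (x, y); Q] ∂P + Var[fun x => ∫ y, g (x, y) ∂Q; P] := by
  rw [variance_eq_sub hg, variance_eq_sub (memLp_two_integral_right hg), integral_variance_eq hg,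
    integral_prod _ (hg.integrable one_le_two)]
  simp only [Pi.pow_apply]
  ring

lemma variance_prod_le [IsProbabilityMeasure P] [IsProbabilityMeasure Q] {g : α × β → ℝ}
    {b : α → ℝ} {K : ℝ} (hg : MemLp g 2 (P.prod Q)) (hb : MemLp b 2 P)
    (hfst : ∀ x x' y, |g (x, y) - g (x', y)| ≤ b x + b x')
    (hsnd : ∀ᵐ x ∂P, Var[fun y => g (x, y); Q] ≤ K) :
    Var[g; P.prod Q] ≤ 2 * ∫ x, b x ^ 2 ∂P + K := by
  have hmean : ∫ x, Var[fun y => g (x, y); Q] ∂P ≤ K := by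
    refine (integral_mono_of_nonneg (.of_forall fun x => variance_nonneg _ _)
      (integrable_const K) hsnd).trans_eq ?_
    simp only [integral_const, probReal_univ, one_smul]
  have hsec : ∀ᵐ x ∂P, Integrable (fun y => g (x, y)) Q :=
    (hg.integrable one_le_two).prod_right_ae
  have hvar : Var[fun x => ∫ y, g (x, y) ∂Q; P] ≤ 2 * ∫ x, b x ^ 2 ∂P := by
    refine variance_le_of_abs_sub_le (memLp_two_integral_right hg) hb ?_
    filter_upwards [Measure.quasiMeasurePreserving_fst.ae hsec,
      Measure.quasiMeasurePreserving_snd.ae hsec] with z hz₁ hz₂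
    rw [← integral_sub hz₁ hz₂]
    simpa only [probReal_univ, mul_one, Real.norm_eq_abs] using
      norm_integral_le_of_norm_le_const (μ := Q) (f := fun y => g (z.1, y) - g (z.2, y))
        (.of_forall fun y => hfst z.1 z.2 y)
  rw [variance_prod_eq hg]
  linarith

/-- A bounded-difference form of the Efron–Stein inequality. -/
theorem variance_pi_le_of_abs_update_sub_le {n : ℕ} {α : Fin n → Type*}
    [∀ i, MeasurableSpace (α i)] {P : ∀ i, Measure (α i)} [∀ i, IsProbabilityMeasure (P i)]
    {g : (∀ i, α i) → ℝ} {b : ∀ i, α i → ℝ} (hg : MemLp g 2 (Measure.pi P))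
    (hb : ∀ i, MemLp (b i) 2 (P i))
    (hdiff : ∀ i x y, |g (Function.update x i y) - g x| ≤ b i y + b i (x i)) :
    Var[g; Measure.pi P] ≤ 2 * ∑ i, ∫ x, b i x ^ 2 ∂(P i) := by
  induction n with
  | zero =>
    have hconst : g = fun _ => g default := funext fun x => by rw [Subsingleton.elim x default]
    rw [hconst, variance_eq_sub (memLp_const _)]
    simp
  | succ n ih =>
    set e := (MeasurableEquiv.piFinSuccAbove α 0).symm
    have he : MeasurePreserving e ((P 0).prod (Measure.pi fun j => P (Fin.succAbove 0 j)))
        (Measure.pi P) := (measurePreserving_piFinSuccAbove P 0).symm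
    rw [← he.variance_fun_comp hg.aemeasurable, Fin.sum_univ_succAbove _ 0, mul_add]
    have hge := hg.comp_measurePreserving he
    refine variance_prod_le hge (hb 0) (fun x x' y => ?_) ?_
    · have h := hdiff 0 (Fin.insertNth 0 x' y) x
      rwa [Fin.update_insertNth, Fin.insertNth_apply_same] at h
    · filter_upwards [memLp_two_section_ae hge] with x hx
      refine ih hx (fun j => hb _) fun j y y' => ?_
      have h := hdiff (Fin.succAbove 0 j) (Fin.insertNth 0 x y) y'
      rwa [← Fin.insertNth_update, Fin.insertNth_apply_succAbove] at h

lemma sum_sq_integral_mul_le_of_forall_integral_sq_le {ι : Type*} [Fintype ι] {q : α → ℝ}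
    {X : ι → α → ℝ} (hq : MemLp q 2 P) (hX : ∀ j, MemLp (X j) 2 P)
    (hBessel : ∀ c : ι → ℝ, ∫ x, (∑ j, c j * X j x) ^ 2 ∂P ≤ ∑ j, c j ^ 2) :
    ∑ j, (∫ x, q x * X j x ∂P) ^ 2 ≤ ∫ x, q x ^ 2 ∂P := by
  set c : ι → ℝ := fun j => ∫ x, q x * X j x ∂P
  have hS : MemLp (fun x => ∑ j, c j * X j x) 2 P :=
    memLp_finsetSum _ fun j _ => (hX j).const_mul (c j)
  have hqX : ∀ j, Integrable (fun x => q x * X j x) P := fun j => hq.integrable_mul (hX j)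
  have hqS : Integrable (fun x => q x * ∑ j, c j * X j x) P := hq.integrable_mul hS
  have hcross : ∫ x, q x * ∑ j, c j * X j x ∂P = ∑ j, c j ^ 2 := by
    simp_rw [Finset.mul_sum, mul_left_comm (q _)]
    rw [integral_finsetSum _ fun j _ => (hqX j).const_mul _]
    simp_rw [integral_const_mul, sq]
    rfl
  have hsub : Integrable (fun x => q x ^ 2 - 2 * (q x * ∑ j, c j * X j x)) P :=
    hq.integrable_sq.sub (hqS.const_mul 2)
  have hsq : 0 ≤ ∫ x, (q x ^ 2 - 2 * (q x * ∑ j, c j * X j x) + (∑ j, c j * X j x) ^ 2) ∂P :=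
    integral_nonneg fun x => (sq_nonneg (q x - ∑ j, c j * X j x)).trans_eq (by ring)
  rw [integral_add hsub hS.integrable_sq,
    integral_sub hq.integrable_sq (hqS.const_mul 2), integral_const_mul, hcross] at hsq
  linarith [hBessel c]

end Variance

section GaussianPoincare

variable {E : Type*} [NormedAddCommGroup E] [NormedSpace ℝ E] {G : E → ℝ} {C : ℝ≥0}

/-- The quarter turn from `z.1` to `z.2`, run over `[0, 1]`: the first component is the position
and, up to the factor `π / 2`, the second one is the velocity. -/
def quarterTurn (z : E × E) (s : ℝ) : E × E := ContinuousLinearMap.rotation (Real.pi / 2 * s) z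

lemma quarterTurn_fst (z : E × E) (s : ℝ) :
    (quarterTurn z s).1 = Real.cos (Real.pi / 2 * s) • z.1 + Real.sin (Real.pi / 2 * s) • z.2 := by
  simp only [quarterTurn, ContinuousLinearMap.rotation_apply]

lemma quarterTurn_snd (z : E × E) (s : ℝ) :
    (quarterTurn z s).2
      = -Real.sin (Real.pi / 2 * s) • z.1 + Real.cos (Real.pi / 2 * s) • z.2 := by
  simp only [quarterTurn, ContinuousLinearMap.rotation_apply]

lemma continuous_quarterTurn : Continuous (Function.uncurry (quarterTurn (E := E))) := by
  unfold quarterTurn Function.uncurry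
  simp only [ContinuousLinearMap.rotation_apply]
  fun_prop

lemma norm_quarterTurn_snd_le (z : E × E) (s : ℝ) : ‖(quarterTurn z s).2‖ ≤ ‖z.1‖ + ‖z.2‖ := by
  rw [quarterTurn_snd]
  refine (norm_add_le _ _).trans (add_le_add ?_ ?_) <;> rw [norm_smul, Real.norm_eq_abs]
  · rw [abs_neg]
    exact mul_le_of_le_one_left (norm_nonneg _) (Real.abs_sin_le_one _)
  · exact mul_le_of_le_one_left (norm_nonneg _) (Real.abs_cos_le_one _)

lemma hasDerivAt_quarterTurn_fst (z : E × E) (s : ℝ) :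
    HasDerivAt (fun s => (quarterTurn z s).1) ((Real.pi / 2) • (quarterTurn z s).2) s := by
  have hlin : HasDerivAt (fun s : ℝ => Real.pi / 2 * s) (Real.pi / 2) s := by
    simpa using (hasDerivAt_id s).const_mul (Real.pi / 2)
  simp only [quarterTurn_fst, quarterTurn_snd, smul_add, smul_smul, mul_comm (Real.pi / 2) (-_),
    mul_comm (Real.pi / 2) (Real.cos _)]
  exact (hlin.cos.smul_const z.1).add (hlin.sin.smul_const z.2)

lemma abs_fderiv_apply_le (hC : LipschitzWith C G) (x y : E) : |fderiv ℝ G x y| ≤ C * ‖y‖ :=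
  ((fderiv ℝ G x).le_opNorm y).trans (by gcongr; exact norm_fderiv_le_of_lipschitz ℝ hC)

variable [SecondCountableTopology E] [MeasurableSpace E] [BorelSpace E]

lemma measurable_fderiv_uncurry (hG : Differentiable ℝ G) :
    Measurable fun z : E × E => fderiv ℝ G z.1 z.2 := by
  simpa only [(hG _).lineDeriv_eq_fderiv] using measurable_lineDeriv_uncurry hG.continuous (𝕜 := ℝ)

lemma memLp_two_fderiv_quarterTurn (hG : Differentiable ℝ G) (hC : LipschitzWith C G)
    (z : E × E) :
    MemLp (fun s => Real.pi / 2 * fderiv ℝ G (quarterTurn z s).1 (quarterTurn z s).2) 2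
      (volume.restrict (Set.Ioc 0 1)) := by
  have hcont : Continuous (quarterTurn z) :=
    continuous_quarterTurn.uncurry_left z
  have hmeas : Measurable fun s => fderiv ℝ G (quarterTurn z s).1 (quarterTurn z s).2 :=
    (measurable_fderiv_uncurry hG).comp hcont.measurable
  have hbound (s : ℝ) : ‖fderiv ℝ G (quarterTurn z s).1 (quarterTurn z s).2‖
      ≤ C * (‖z.1‖ + ‖z.2‖) :=
    (abs_fderiv_apply_le hC _ _).trans (by gcongr; exact norm_quarterTurn_snd_le z s)
  exact (MemLp.of_bound hmeas.aestronglyMeasurable _ (.of_forall hbound)).const_mul _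

lemma sq_sub_le_integral_sq_fderiv_quarterTurn (hG : Differentiable ℝ G) (hC : LipschitzWith C G)
    (z : E × E) :
    (G z.1 - G z.2) ^ 2 ≤ ∫ s in Set.Ioc (0 : ℝ) 1,
      (Real.pi / 2 * fderiv ℝ G (quarterTurn z s).1 (quarterTurn z s).2) ^ 2 := by
  have : IsProbabilityMeasure (volume.restrict (Set.Ioc (0 : ℝ) 1)) := ⟨by simp⟩
  have hH := memLp_two_fderiv_quarterTurn hG hC z
  have hderiv (s : ℝ) : HasDerivAt (fun s => G (quarterTurn z s).1)
      (Real.pi / 2 * fderiv ℝ G (quarterTurn z s).1 (quarterTurn z s).2) s := by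
    have := (hG _).hasFDerivAt.comp_hasDerivAt s (hasDerivAt_quarterTurn_fst z s)
    rwa [map_smul, smul_eq_mul] at this
  have hFTC : ∫ s in Set.Ioc (0 : ℝ) 1,
      Real.pi / 2 * fderiv ℝ G (quarterTurn z s).1 (quarterTurn z s).2 = G z.2 - G z.1 := by
    rw [← intervalIntegral.integral_of_le zero_le_one,
      intervalIntegral.integral_eq_sub_of_hasDerivAt (fun s _ => hderiv s)
        ((intervalIntegrable_iff_integrableOn_Ioc_of_le zero_le_one).2 (hH.integrable one_le_two))]
    simp [quarterTurn_fst]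
  rw [sub_sq_comm, ← hFTC]
  exact sq_integral_le_integral_sq hH

variable [CompleteSpace E] {μ : Measure E} [IsGaussian μ]

lemma memLp_two_of_lipschitzWith (hC : LipschitzWith C G) : MemLp G 2 μ := by
  have hbound : MemLp (fun x : E => C * ‖x‖ + ‖G 0‖) 2 μ :=
    (IsGaussian.memLp_two_id.norm.const_mul (C : ℝ)).add (memLp_const _)
  refine hbound.mono' hC.continuous.aestronglyMeasurable (.of_forall fun x => ?_)
  calc ‖G x‖ ≤ ‖G x - G 0‖ + ‖G 0‖ := norm_le_norm_sub_add _ _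
    _ ≤ C * ‖x‖ + ‖G 0‖ := by
      gcongr
      simpa using hC.norm_sub_le x 0

lemma integrable_sq_fderiv (hG : Differentiable ℝ G) (hC : LipschitzWith C G) :
    Integrable (fun z : E × E => (fderiv ℝ G z.1 z.2) ^ 2) (μ.prod μ) := by
  have hbound : MemLp (fun z : E × E => C * ‖z.2‖) 2 (μ.prod μ) :=
    (IsGaussian.memLp_two_id.norm.comp_snd μ).const_mul (C : ℝ)
  exact (hbound.mono' (measurable_fderiv_uncurry hG).aestronglyMeasurable
    (.of_forall fun z => abs_fderiv_apply_le hC z.1 z.2)).integrable_sq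

lemma integral_sq_fderiv_eq (hμ : μ[id] = 0) (hG : Differentiable ℝ G) (hC : LipschitzWith C G) :
    ∫ z : E × E, (fderiv ℝ G z.1 z.2) ^ 2 ∂(μ.prod μ) = ∫ x, Var[fderiv ℝ G x; μ] ∂μ := by
  rw [integral_prod _ (integrable_sq_fderiv hG hC)]
  refine integral_congr_ae (.of_forall fun x => ?_)
  have hmean : μ[fderiv ℝ G x] = 0 := by
    rw [IsGaussian.integral_dual, show ∫ y, y ∂μ = 0 from hμ, map_zero]
  simp only [variance_of_integral_eq_zero (fderiv ℝ G x).continuous.aemeasurable hmean]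

lemma lintegral_sq_sub_le (hμ : μ[id] = 0) (hG : Differentiable ℝ G) (hC : LipschitzWith C G) :
    ∫⁻ z : E × E, ENNReal.ofReal ((G z.1 - G z.2) ^ 2) ∂(μ.prod μ)
      ≤ ∫⁻ z : E × E, ENNReal.ofReal ((Real.pi / 2 * fderiv ℝ G z.1 z.2) ^ 2) ∂(μ.prod μ) := by
  set F : E × E → ENNReal := fun z => ENNReal.ofReal ((Real.pi / 2 * fderiv ℝ G z.1 z.2) ^ 2)
  have hF : Measurable F :=
    (((measurable_fderiv_uncurry hG).const_mul _).pow_const 2).ennreal_ofReal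
  calc ∫⁻ z : E × E, ENNReal.ofReal ((G z.1 - G z.2) ^ 2) ∂(μ.prod μ)
      ≤ ∫⁻ z, (∫⁻ s in Set.Ioc (0 : ℝ) 1, F (quarterTurn z s)) ∂(μ.prod μ) := by
        refine lintegral_mono fun z => ?_
        rw [← ofReal_integral_eq_lintegral_ofReal
          (memLp_two_fderiv_quarterTurn hG hC z).integrable_sq (.of_forall fun s => sq_nonneg _)]
        exact ENNReal.ofReal_le_ofReal (sq_sub_le_integral_sq_fderiv_quarterTurn hG hC z)
    _ = ∫⁻ s in Set.Ioc (0 : ℝ) 1, (∫⁻ z, F (quarterTurn z s) ∂(μ.prod μ)) :=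
        lintegral_lintegral_swap (hF.comp continuous_quarterTurn.measurable).aemeasurable
    _ = ∫⁻ _ in Set.Ioc (0 : ℝ) 1, (∫⁻ z, F z ∂(μ.prod μ)) := by
        refine lintegral_congr fun s => ?_
        conv_rhs => rw [← IsGaussian.map_rotation_eq_self hμ (Real.pi / 2 * s)]
        exact (lintegral_map hF (ContinuousLinearMap.continuous _).measurable).symm
    _ = ∫⁻ z, F z ∂(μ.prod μ) := by simp

/-- A Gaussian Poincaré inequality. The constant `π ^ 2 / 8` is what the quarter turn between two
independent copies gives; it is not optimal. -/
theorem variance_le_integral_variance_fderiv (hμ : μ[id] = 0) (hG : Differentiable ℝ G)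
    (hC : LipschitzWith C G) :
    Var[G; μ] ≤ Real.pi ^ 2 / 8 * ∫ x, Var[fderiv ℝ G x; μ] ∂μ := by
  have hGm : AEStronglyMeasurable (fun z : E × E => (G z.1 - G z.2) ^ 2) (μ.prod μ) :=
    Continuous.aestronglyMeasurable (by have := hG.continuous; fun_prop)
  have hH : Integrable (fun z : E × E => (Real.pi / 2 * fderiv ℝ G z.1 z.2) ^ 2) (μ.prod μ) := by
    simp_rw [mul_pow]
    exact (integrable_sq_fderiv hG hC).const_mul _
  have hpath : ∫ z : E × E, (G z.1 - G z.2) ^ 2 ∂(μ.prod μ)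
      ≤ ∫ z : E × E, (Real.pi / 2 * fderiv ℝ G z.1 z.2) ^ 2 ∂(μ.prod μ) := by
    rw [integral_eq_lintegral_of_nonneg_ae (.of_forall fun z => sq_nonneg _) hGm]
    refine ENNReal.toReal_le_of_le_ofReal (integral_nonneg fun z => sq_nonneg _) ?_
    rw [ofReal_integral_eq_lintegral_ofReal hH (.of_forall fun z => sq_nonneg _)]
    exact lintegral_sq_sub_le hμ hG hC
  simp_rw [mul_pow] at hpath
  rw [← two_mul_variance_eq (memLp_two_of_lipschitzWith hC), integral_const_mul,
    integral_sq_fderiv_eq hμ hG hC] at hpath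
  linarith

end GaussianPoincare

section GaussianArrays

variable {ι : Type*} [Fintype ι] {E : ι → Type*} [∀ i, NormedAddCommGroup (E i)]
  [∀ i, NormedSpace ℝ (E i)] [∀ i, MeasurableSpace (E i)] {μ : ∀ i, Measure (E i)}

lemma variance_dual_pi [DecidableEq ι] [∀ i, IsProbabilityMeasure (μ i)]
    (L : StrongDual ℝ (∀ i, E i)) (hμ : ∀ i, MemLp id 2 (μ i)) :
    Var[L; Measure.pi μ] = ∑ i, Var[L.comp (.single ℝ E i); μ i] := by
  have hL : ⇑L = ∑ i, fun x => L.comp (.single ℝ E i) (x i) := by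
    ext x
    rw [Finset.sum_apply, L.sum_comp_single]
  rw [hL]
  exact variance_sum_pi fun i => ContinuousLinearMap.comp_memLp' _ (hμ i)

variable [∀ i, CompleteSpace (E i)] [∀ i, BorelSpace (E i)]
  [∀ i, SecondCountableTopology (E i)] [∀ i, IsGaussian (μ i)]

variable (μ) in
lemma isGaussian_pi : IsGaussian (Measure.pi μ) := by
  have hindep : iIndepFun (fun i (ω : ∀ i, E i) => ω i) (Measure.pi μ) :=
    iIndepFun_pi (X := fun i (x : E i) => x) fun i => aemeasurable_id
  have hlaw := hindep.hasGaussianLaw fun i => ⟨by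
    rw [(measurePreserving_eval μ i).map_eq]; infer_instance⟩
  simpa using hlaw.isGaussian_map

lemma integral_id_pi_eq_zero (hμ : ∀ i, (μ i)[id] = 0) : (Measure.pi μ)[id] = 0 := by
  ext i
  have := isGaussian_pi μ
  have hint : ∀ i, Integrable (fun x : ∀ i, E i => x i) (Measure.pi μ) := fun i =>
    integrable_comp_eval (f := id) (IsGaussian.memLp_two_id.integrable one_le_two)
  exact (eval_integral hint i).trans
    ((integral_comp_eval (f := id) aestronglyMeasurable_id).trans (hμ i))

end GaussianArrays

section WeightLaw

instance (m : ℕ) : IsGaussian (gaussVec m) := isGaussian_pi _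

instance (m l : ℕ) : IsGaussian (gaussMat m l) := isGaussian_pi _

instance (d p n : ℕ) : IsProbabilityMeasure (prior d p n) := by
  unfold prior; infer_instance

instance {k : ℕ} (d p n : ℕ) (PA : Measure (Fin k → ℝ)) [IsProbabilityMeasure PA] :
    IsProbabilityMeasure (disorderLaw d p n PA) := by
  unfold disorderLaw; infer_instance

/-- The inner weights `(W, v)`. -/
abbrev Weights (d p : ℕ) : Type := (Fin p → Fin d → ℝ) × (Fin d → ℝ)

/-- The law of the teacher's inner weights `(W*, v*)`. -/
def weightLaw (d p : ℕ) : Measure (Weights d p) := (gaussMat p d).prod (gaussVec d)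

instance (d p : ℕ) : IsGaussian (weightLaw d p) := by
  unfold weightLaw; infer_instance

lemma integral_id_gaussVec (m : ℕ) : (gaussVec m)[id] = 0 :=
  integral_id_pi_eq_zero fun _ => integral_id_gaussianReal

lemma integral_id_gaussMat (m l : ℕ) : (gaussMat m l)[id] = 0 :=
  integral_id_pi_eq_zero fun _ => integral_id_gaussVec l

lemma integral_id_weightLaw (d p : ℕ) : (weightLaw d p)[id] = 0 := by
  have hint : Integrable id (weightLaw d p) := IsGaussian.memLp_two_id.integrable one_le_two
  ext1
  · rw [fst_integral hint]
    refine (integral_fun_fst fun W => W).trans ?_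
    rw [show ∫ W, W ∂gaussMat p d = 0 from integral_id_gaussMat p d, smul_zero, Prod.fst_zero]
  · rw [snd_integral hint]
    refine (integral_fun_snd fun v => v).trans ?_
    rw [show ∫ v, v ∂gaussVec d = 0 from integral_id_gaussVec d, smul_zero, Prod.snd_zero]

lemma variance_dual_gaussianReal (L : StrongDual ℝ ℝ) : Var[L; gaussianReal 0 1] = L 1 ^ 2 := by
  have hL : ⇑L = fun x => L 1 * x := funext fun x => by
    rw [mul_comm, ← smul_eq_mul, ← map_smul, smul_eq_mul, mul_one]
  rw [hL, variance_const_mul, variance_fun_id_gaussianReal]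
  simp

lemma variance_dual_gaussVec {m : ℕ} (L : StrongDual ℝ (Fin m → ℝ)) :
    Var[L; gaussVec m] = ∑ j, L (Pi.single j 1) ^ 2 := by
  rw [gaussVec, variance_dual_pi L fun _ => IsGaussian.memLp_two_id]
  simp only [variance_dual_gaussianReal, ContinuousLinearMap.comp_apply,
    ContinuousLinearMap.single_apply]

lemma variance_dual_gaussMat {m l : ℕ} (L : StrongDual ℝ (Fin m → Fin l → ℝ)) :
    Var[L; gaussMat m l] = ∑ i, ∑ j, L (Pi.single i (Pi.single j 1)) ^ 2 := by
  rw [gaussMat, variance_dual_pi L fun _ => IsGaussian.memLp_two_id]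
  simp only [variance_dual_gaussVec, ContinuousLinearMap.comp_apply,
    ContinuousLinearMap.single_apply]

lemma variance_dual_weightLaw {d p : ℕ} (L : StrongDual ℝ (Weights d p)) :
    Var[L; weightLaw d p] = ∑ i, ∑ j, L (Pi.single i (Pi.single j 1), 0) ^ 2
      + ∑ j, L (0, Pi.single j 1) ^ 2 := by
  rw [weightLaw, variance_dual_prod IsGaussian.memLp_two_id IsGaussian.memLp_two_id,
    variance_dual_gaussMat, variance_dual_gaussVec]
  rfl

lemma memLp_two_eval_gaussVec {m : ℕ} (j : Fin m) :
    MemLp (fun x : Fin m → ℝ => x j) 2 (gaussVec m) :=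
  IsGaussian.memLp_two_id.comp_measurePreserving (measurePreserving_eval _ j)

lemma integral_sq_sum_mul_gaussVec {m : ℕ} (c : Fin m → ℝ) :
    ∫ x, (∑ j, c j * x j) ^ 2 ∂(gaussVec m) = ∑ j, c j ^ 2 := by
  set L : StrongDual ℝ (Fin m → ℝ) := ∑ j, c j • .proj j
  have hL (x : Fin m → ℝ) : L x = ∑ j, c j * x j := by simp [L]
  have hmean : (gaussVec m)[L] = 0 := by
    rw [IsGaussian.integral_dual]
    exact (congrArg L (integral_id_gaussVec m)).trans (map_zero L)
  simp_rw [← hL]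
  rw [← variance_of_integral_eq_zero L.continuous.aemeasurable hmean, variance_dual_gaussVec]
  simp [hL, Pi.single_apply]

end WeightLaw

section Regrouping

/-- The disorder attached to one sample: `(ξ_μ, X_μ, A_μ, Z_μ)`. -/
abbrev Sample (d k : ℕ) : Type := ℝ × (Fin d → ℝ) × (Fin k → ℝ) × ℝ

/-- The law of the disorder attached to one sample. -/
def sampleLaw {k : ℕ} (d : ℕ) (PA : Measure (Fin k → ℝ)) : Measure (Sample d k) :=
  (gaussianReal 0 1).prod ((gaussVec d).prod (PA.prod (gaussianReal 0 1)))

/-- The law of `n` independent samples. -/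
def samplesLaw {k : ℕ} (d n : ℕ) (PA : Measure (Fin k → ℝ)) : Measure (Fin n → Sample d k) :=
  Measure.pi fun _ => sampleLaw d PA

/-- The disorder regrouped from the inner weights and the list of samples. -/
def toDisorder {d p n k : ℕ} (q : Weights d p × (Fin n → Sample d k)) : Disorder d p n k :=
  (q.1.1, q.1.2, fun μ => (q.2 μ).1, fun μ => (q.2 μ).2.1, fun μ => (q.2 μ).2.2.1,
    fun μ => (q.2 μ).2.2.2)

variable {k : ℕ} (d p n : ℕ) (PA : Measure (Fin k → ℝ)) [IsProbabilityMeasure PA]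

instance : IsProbabilityMeasure (sampleLaw d PA) := by
  unfold sampleLaw; infer_instance

instance : IsProbabilityMeasure (samplesLaw d n PA) := by
  unfold samplesLaw; infer_instance

lemma measurePreserving_toDisorder :
    MeasurePreserving toDisorder ((weightLaw d p).prod (samplesLaw d n PA))
      (disorderLaw d p n PA) := by
  have splitAZ := measurePreserving_arrowProdEquivProdArrow (Fin k → ℝ) ℝ (Fin n)
    (fun _ => PA) (fun _ => gaussianReal 0 1)
  have splitX := measurePreserving_arrowProdEquivProdArrow (Fin d → ℝ) ((Fin k → ℝ) × ℝ) (Fin n)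
    (fun _ => gaussVec d) (fun _ => PA.prod (gaussianReal 0 1))
  have splitξ := measurePreserving_arrowProdEquivProdArrow ℝ ((Fin d → ℝ) × (Fin k → ℝ) × ℝ)
    (Fin n) (fun _ => gaussianReal 0 1) (fun _ => (gaussVec d).prod (PA.prod (gaussianReal 0 1)))
  have splitXAZ := ((MeasurePreserving.id (gaussMat n d)).prod splitAZ).comp splitX
  have split := ((MeasurePreserving.id (gaussVec n)).prod splitXAZ).comp splitξ
  exact (measurePreserving_prodAssoc (gaussMat p d) (gaussVec d) _).comp
    ((MeasurePreserving.id (weightLaw d p)).prod split)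

end Regrouping

section LogIntegralExp

variable {Θ : Type*} [MeasurableSpace Θ] {π : Measure Θ} {u v : Θ → ℝ} {c : ℝ}

lemma integrable_exp_of_abs_le [IsFiniteMeasure π] (hu : AEMeasurable u π)
    (hc : ∀ᵐ θ ∂π, |u θ| ≤ c) : Integrable (fun θ => Real.exp (u θ)) π := by
  refine Integrable.of_bound (Real.measurable_exp.comp_aemeasurable hu).aestronglyMeasurable
    (Real.exp c) ?_
  filter_upwards [hc] with θ hθ
  rw [Real.norm_of_nonneg (Real.exp_nonneg _)]
  exact Real.exp_le_exp.2 ((le_abs_self _).trans hθ)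

lemma log_integral_exp_le_add [NeZero π] (hu : Integrable (fun θ => Real.exp (u θ)) π)
    (hv : Integrable (fun θ => Real.exp (v θ)) π) (h : ∀ θ, u θ ≤ c + v θ) :
    Real.log (∫ θ, Real.exp (u θ) ∂π) ≤ c + Real.log (∫ θ, Real.exp (v θ) ∂π) := by
  rw [← Real.log_exp c, ← Real.log_mul (Real.exp_ne_zero _) (integral_exp_pos hv).ne',
    ← integral_const_mul]
  refine Real.log_le_log (integral_exp_pos hu) (integral_mono hu (hv.const_mul _) fun θ => ?_)
  simpa only [← Real.exp_add, Real.exp_le_exp] using h θ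

lemma abs_log_integral_exp_sub_le [NeZero π] (hu : Integrable (fun θ => Real.exp (u θ)) π)
    (hv : Integrable (fun θ => Real.exp (v θ)) π) (h : ∀ θ, |u θ - v θ| ≤ c) :
    |Real.log (∫ θ, Real.exp (u θ) ∂π) - Real.log (∫ θ, Real.exp (v θ) ∂π)| ≤ c := by
  refine abs_sub_le_iff.2 ⟨?_, ?_⟩
  · linarith [log_integral_exp_le_add hu hv fun θ => by linarith [(abs_sub_le_iff.1 (h θ)).1]]
  · linarith [log_integral_exp_le_add hv hu fun θ => by linarith [(abs_sub_le_iff.1 (h θ)).2]]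

lemma abs_log_integral_exp_le [IsProbabilityMeasure π] (hu : AEMeasurable u π)
    (hc : ∀ θ, |u θ| ≤ c) : |Real.log (∫ θ, Real.exp (u θ) ∂π)| ≤ c := by
  simpa using abs_log_integral_exp_sub_le (v := 0) (π := π)
    (integrable_exp_of_abs_le hu (.of_forall hc)) (by simp) (by simpa using hc)

lemma abs_integral_le_of_abs_le [IsZeroOrProbabilityMeasure π] (hc : 0 ≤ c)
    (hu : ∀ θ, |u θ| ≤ c) : |∫ θ, u θ ∂π| ≤ c :=
  (norm_integral_le_of_norm_le_const (f := u) (.of_forall hu)).trans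
    (mul_le_of_le_one_right hc measureReal_le_one)

lemma measurable_integral_tilted {X E : Type*} [MeasurableSpace X] [NormedAddCommGroup E]
    [NormedSpace ℝ E] [MeasurableSpace E] [BorelSpace E] [SecondCountableTopology E] [SFinite π]
    {F : X → Θ → ℝ} {g : X → Θ → E} (hF : Measurable (Function.uncurry F))
    (hg : Measurable (Function.uncurry g)) :
    Measurable fun x => ∫ θ, g x θ ∂(π.tilted (F x)) := by
  simp_rw [integral_tilted]
  have hexp : Measurable fun q : X × Θ => Real.exp (F q.1 q.2) := hF.exp
  have hZ : Measurable fun x => ∫ θ, Real.exp (F x θ) ∂π :=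
    hexp.stronglyMeasurable.integral_prod_right'.measurable
  have hweighted : Measurable fun q : X × Θ =>
      (Real.exp (F q.1 q.2) / ∫ θ, Real.exp (F q.1 θ) ∂π) • g q.1 q.2 :=
    (hexp.div (hZ.comp measurable_fst)).smul hg
  exact hweighted.stronglyMeasurable.integral_prod_right'.measurable

lemma hasFDerivAt_log_integral_exp [NeZero π] {H : Type*} [NormedAddCommGroup H] [NormedSpace ℝ H]
    {F : H → Θ → ℝ} {F' : H → Θ → StrongDual ℝ H} {x₀ : H} {s : Set H} {bound : Θ → ℝ}
    (hs : s ∈ nhds x₀) (hF : ∀ᶠ x in nhds x₀, AEMeasurable (F x) π)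
    (hint : Integrable (fun θ => Real.exp (F x₀ θ)) π) (hF' : AEStronglyMeasurable (F' x₀) π)
    (hbound : ∀ᵐ θ ∂π, ∀ x ∈ s, ‖Real.exp (F x θ) • F' x θ‖ ≤ bound θ)
    (hbound_int : Integrable bound π)
    (hderiv : ∀ᵐ θ ∂π, ∀ x ∈ s, HasFDerivAt (fun x => F x θ) (F' x θ) x) :
    HasFDerivAt (fun x => Real.log (∫ θ, Real.exp (F x θ) ∂π))
      (∫ θ, F' x₀ θ ∂(π.tilted (F x₀))) x₀ := by
  have hZ := hasFDerivAt_integral_of_dominated_of_fderiv_le (𝕜 := ℝ) (μ := π)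
    (F := fun x θ => Real.exp (F x θ)) (F' := fun x θ => Real.exp (F x θ) • F' x θ) hs
    (hF.mono fun x hx => (Real.measurable_exp.comp_aemeasurable hx).aestronglyMeasurable) hint
    (hint.aestronglyMeasurable.smul hF') hbound hbound_int
    (hderiv.mono fun θ hθ x hx => (hθ x hx).exp)
  refine (hZ.log (integral_exp_pos hint).ne').congr_fderiv ?_
  rw [integral_tilted, ← integral_smul]
  simp only [smul_smul, div_eq_inv_mul]

lemma hasDerivAt_log_integral_exp [NeZero π] {F F' : ℝ → Θ → ℝ} {x₀ : ℝ} {s : Set ℝ}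
    {bound : Θ → ℝ} (hs : s ∈ nhds x₀) (hF : ∀ᶠ x in nhds x₀, AEMeasurable (F x) π)
    (hint : Integrable (fun θ => Real.exp (F x₀ θ)) π) (hF' : AEStronglyMeasurable (F' x₀) π)
    (hbound : ∀ᵐ θ ∂π, ∀ x ∈ s, |Real.exp (F x θ) * F' x θ| ≤ bound θ)
    (hbound_int : Integrable bound π)
    (hderiv : ∀ᵐ θ ∂π, ∀ x ∈ s, HasDerivAt (fun x => F x θ) (F' x θ) x) :
    HasDerivAt (fun x => Real.log (∫ θ, Real.exp (F x θ) ∂π))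
      (∫ θ, F' x₀ θ ∂(π.tilted (F x₀))) x₀ := by
  have hZ := hasDerivAt_integral_of_dominated_loc_of_deriv_le (𝕜 := ℝ) (μ := π)
    (F := fun x θ => Real.exp (F x θ)) (F' := fun x θ => Real.exp (F x θ) * F' x θ) hs
    (hF.mono fun x hx => (Real.measurable_exp.comp_aemeasurable hx).aestronglyMeasurable) hint
    (hint.aestronglyMeasurable.mul hF') hbound hbound_int
    (hderiv.mono fun θ hθ x hx => (hθ x hx).exp)
  refine (hZ.2.log (integral_exp_pos hint).ne').congr_deriv ?_
  rw [integral_tilted, div_eq_inv_mul, ← integral_const_mul]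
  simp only [smul_eq_mul, div_eq_inv_mul, mul_assoc]

end LogIntegralExp

section Channel

variable {k : ℕ} {PA : Measure (Fin k → ℝ)} {f : ℝ → (Fin k → ℝ) → ℝ} {K Δ : ℝ}
  {α : Type*} [MeasurableSpace α]

/-- A readout that is differentiable in its first argument, with values and derivatives bounded
by `K`, for every value of its second argument. -/
structure ReadoutBound (f : ℝ → (Fin k → ℝ) → ℝ) (K : ℝ) : Prop where
  measurable : Measurable (Function.uncurry f)
  differentiable : ∀ A, Differentiable ℝ fun x => f x A
  bdd : ∀ x A, |f x A| ≤ K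
  bdd_deriv : ∀ x A, |deriv (fun x => f x A) x| ≤ K

namespace ReadoutBound

lemma nonneg (hf : ReadoutBound f K) : 0 ≤ K := (abs_nonneg _).trans (hf.bdd 0 0)

lemma measurable_deriv (hf : ReadoutBound f K) :
    Measurable fun q : ℝ × (Fin k → ℝ) => deriv (fun x => f x q.2) q.1 := by
  let h (m : ℕ) : ℝ := 1 / ((m : ℝ) + 1)
  have hh : Filter.Tendsto h Filter.atTop (nhdsWithin 0 {0}ᶜ) :=
    tendsto_nhdsWithin_iff.2 ⟨tendsto_one_div_add_atTop_nhds_zero_nat,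
      .of_forall fun m => (Nat.one_div_pos_of_nat (n := m)).ne'⟩
  have hmeas := hf.measurable
  refine measurable_of_tendsto_metrizable
    (f := fun m (q : ℝ × (Fin k → ℝ)) => (h m)⁻¹ • (f (q.1 + h m) q.2 - f q.1 q.2))
    (fun m => by fun_prop) (tendsto_pi_nhds.2 fun q => ?_)
  exact (hasDerivAt_iff_tendsto_slope_zero.1
    (hf.differentiable q.2 q.1).hasDerivAt).comp hh

lemma abs_sub_le (hf : ReadoutBound f K) (y x : ℝ) (A : Fin k → ℝ) :
    |f x A - y| ≤ |y| + K := by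
  linarith [abs_sub (f x A) y, hf.bdd x A]

end ReadoutBound

/-- The exponent of the Gaussian density that `P_out (y | x)` averages over the readout
randomness `A`. -/
def channelExponent (f : ℝ → (Fin k → ℝ) → ℝ) (Δ y x : ℝ) (A : Fin k → ℝ) : ℝ :=
  -(1 / (2 * Δ)) * (y - f x A) ^ 2

lemma hasDerivAt_channelExponent (f : ℝ → (Fin k → ℝ) → ℝ) (Δ y x : ℝ) (A : Fin k → ℝ) :
    HasDerivAt (fun y => channelExponent f Δ y x A) ((f x A - y) / Δ) y := by
  refine ((((hasDerivAt_id' y).sub_const (f x A)).fun_pow 2).const_mul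
    (-(1 / (2 * Δ)))).congr_deriv ?_
  rw [one_div, mul_inv]
  ring

lemma channelExponent_nonpos (f : ℝ → (Fin k → ℝ) → ℝ) (hΔ : 0 < Δ) (y x : ℝ) (A : Fin k → ℝ) :
    channelExponent f Δ y x A ≤ 0 :=
  mul_nonpos_of_nonpos_of_nonneg (neg_nonpos.2 (by positivity)) (sq_nonneg _)

/-- The derivative of `log P_out (y | x)` in `y`: the mean of the derivative of the channel
exponent under the conditional law of the readout randomness given the response `y`. -/
def score (PA : Measure (Fin k → ℝ)) (f : ℝ → (Fin k → ℝ) → ℝ) (Δ y x : ℝ) : ℝ :=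
  ∫ A, (f x A - y) / Δ ∂(PA.tilted (channelExponent f Δ y x))

namespace ReadoutBound

lemma abs_channelExponent_le (hf : ReadoutBound f K) (hΔ : 0 < Δ) (y x : ℝ) (A : Fin k → ℝ) :
    |channelExponent f Δ y x A| ≤ (|y| + K) ^ 2 / (2 * Δ) := by
  have hsq : (y - f x A) ^ 2 ≤ (|y| + K) ^ 2 :=
    sq_le_sq' (by linarith [neg_abs_le (y - f x A), abs_sub_comm y (f x A), hf.abs_sub_le y x A])
      (by linarith [le_abs_self (y - f x A), abs_sub_comm y (f x A), hf.abs_sub_le y x A])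
  rw [channelExponent, abs_mul, abs_neg, abs_of_nonneg (by positivity), abs_sq, one_div_mul_eq_div]
  gcongr

lemma measurable_channelExponent (hf : ReadoutBound f K) {y x : α → ℝ} (hy : Measurable y)
    (hx : Measurable x) :
    Measurable (Function.uncurry fun q => channelExponent f Δ (y q) (x q)) := by
  have hmeas := hf.measurable
  unfold channelExponent Function.uncurry
  fun_prop

lemma measurable_channelExponent_right (hf : ReadoutBound f K) (Δ y x : ℝ) :
    Measurable (channelExponent f Δ y x) :=
  (hf.measurable_channelExponent measurable_const measurable_const).of_uncurry_left (x := ())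

lemma measurable_logPout [SFinite PA] (hf : ReadoutBound f K) {y x : α → ℝ} (hy : Measurable y)
    (hx : Measurable x) : Measurable fun q => logPout PA f Δ (y q) (x q) :=
  Real.measurable_log.comp ((hf.measurable_channelExponent
    hy hx).exp.const_mul _).stronglyMeasurable.integral_prod_right'.measurable

lemma measurable_score [SFinite PA] (hf : ReadoutBound f K) {y x : α → ℝ} (hy : Measurable y)
    (hx : Measurable x) : Measurable fun q => score PA f Δ (y q) (x q) := by
  have hmeas := hf.measurable
  exact measurable_integral_tilted (hf.measurable_channelExponent hy hx)
    (by unfold Function.uncurry; fun_prop)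

lemma abs_score_le (hf : ReadoutBound f K) (hΔ : 0 < Δ) (y x : ℝ) :
    |score PA f Δ y x| ≤ (|y| + K) / Δ := by
  have hK := hf.nonneg
  refine abs_integral_le_of_abs_le (by positivity) fun A => ?_
  rw [abs_div, abs_of_pos hΔ]
  exact div_le_div_of_nonneg_right (hf.abs_sub_le y x A) hΔ.le

lemma integrable_exp_channelExponent [IsFiniteMeasure PA] (hf : ReadoutBound f K) (hΔ : 0 < Δ)
    (y x : ℝ) : Integrable (fun A => Real.exp (channelExponent f Δ y x A)) PA :=
  integrable_exp_of_abs_le (hf.measurable_channelExponent_right Δ y x).aemeasurable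
    (.of_forall (hf.abs_channelExponent_le hΔ y x))

variable [IsProbabilityMeasure PA]

lemma logPout_eq (hf : ReadoutBound f K) (hΔ : 0 < Δ) (y x : ℝ) :
    logPout PA f Δ y x = Real.log (1 / √(2 * Real.pi * Δ))
      + Real.log (∫ A, Real.exp (channelExponent f Δ y x A) ∂PA) := by
  rw [← Real.log_mul (by positivity)
    (integral_exp_pos (hf.integrable_exp_channelExponent hΔ y x)).ne', ← integral_const_mul]
  rfl

lemma abs_logPout_le (hf : ReadoutBound f K) (hΔ : 0 < Δ) (y x : ℝ) :
    |logPout PA f Δ y x| ≤ |Real.log (1 / √(2 * Real.pi * Δ))| + (|y| + K) ^ 2 / (2 * Δ) := by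
  rw [hf.logPout_eq hΔ]
  refine (abs_add_le _ _).trans (add_le_add_right (abs_log_integral_exp_le
    (hf.measurable_channelExponent_right Δ y x).aemeasurable (hf.abs_channelExponent_le hΔ y x)) _)

lemma hasDerivAt_logPout (hf : ReadoutBound f K) (hΔ : 0 < Δ) (y x : ℝ) :
    HasDerivAt (fun y => logPout PA f Δ y x) (score PA f Δ y x) y := by
  have hfx : Measurable (f x) := hf.measurable.of_uncurry_left
  simp_rw [hf.logPout_eq hΔ]
  refine (hasDerivAt_log_integral_exp (F := fun y => channelExponent f Δ y x)
    (bound := fun _ => (|y| + 1 + K) / Δ) (Metric.ball_mem_nhds y one_pos)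
    (.of_forall fun z => (hf.measurable_channelExponent_right Δ z x).aemeasurable)
    (hf.integrable_exp_channelExponent hΔ y x) (by fun_prop) ?_ (integrable_const _)
    (.of_forall fun A z _ => hasDerivAt_channelExponent f Δ z x A)).const_add _
  refine .of_forall fun A z hz => ?_
  have hz : |z| ≤ |y| + 1 := by
    linarith [abs_sub_abs_le_abs_sub z y, (Metric.mem_ball.1 hz).le, Real.dist_eq z y]
  rw [abs_mul, Real.abs_exp, abs_div, abs_of_pos hΔ]
  refine (mul_le_of_le_one_left (by positivity)
    (Real.exp_le_one_iff.2 (channelExponent_nonpos f hΔ z x A))).trans ?_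
  gcongr
  linarith [hf.abs_sub_le z x A]

end ReadoutBound

end Channel

section Posterior

lemma norm_proj_le_one {ι : Type*} [Fintype ι] {E : ι → Type*} [∀ i, NormedAddCommGroup (E i)]
    [∀ i, NormedSpace ℝ (E i)] (i : ι) : ‖(.proj i : (∀ i, E i) →L[ℝ] E i)‖ ≤ 1 :=
  ContinuousLinearMap.opNorm_le_bound _ zero_le_one fun x => by
    simpa using norm_le_pi_norm x i

variable {k : ℕ} {PA : Measure (Fin k → ℝ)} {f : ℝ → (Fin k → ℝ) → ℝ} {K Δ : ℝ}
  {ι Θ : Type*} [Fintype ι] [MeasurableSpace Θ] {π : Measure Θ}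

/-- The log-likelihood of the responses `Y` under the fields `s`. -/
def logLik (PA : Measure (Fin k → ℝ)) (f : ℝ → (Fin k → ℝ) → ℝ) (Δ : ℝ) (Y s : ι → ℝ) : ℝ :=
  ∑ μ, logPout PA f Δ (Y μ) (s μ)

/-- The posterior mean, given the responses `Y`, of the score of the `μ`-th response, for the
prior `π` on the parameters and the fields `s`. -/
def meanScore (π : Measure Θ) (PA : Measure (Fin k → ℝ)) (f : ℝ → (Fin k → ℝ) → ℝ) (Δ : ℝ)
    (s : Θ → ι → ℝ) (Y : ι → ℝ) (μ : ι) : ℝ :=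
  ∫ θ, score PA f Δ (Y μ) (s θ μ) ∂(π.tilted fun θ => logLik PA f Δ Y (s θ))

namespace ReadoutBound

lemma measurable_logLik [SFinite PA] (hf : ReadoutBound f K) {Y s : Θ → ι → ℝ}
    (hY : Measurable Y) (hs : Measurable s) : Measurable fun θ => logLik PA f Δ (Y θ) (s θ) :=
  Finset.measurable_fun_sum _ fun _ _ => hf.measurable_logPout (by fun_prop) (by fun_prop)

lemma abs_meanScore_le (hf : ReadoutBound f K) (hΔ : 0 < Δ) (s : Θ → ι → ℝ) (Y : ι → ℝ) (μ : ι) :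
    |meanScore π PA f Δ s Y μ| ≤ (|Y μ| + K) / Δ := by
  have hK := hf.nonneg
  exact abs_integral_le_of_abs_le (by positivity) fun θ => hf.abs_score_le hΔ _ _

lemma norm_sum_score_smul_proj_le (hf : ReadoutBound f K) (hΔ : 0 < Δ) (Y s : ι → ℝ) :
    ‖∑ μ, score PA f Δ (Y μ) (s μ) • (.proj μ : StrongDual ℝ (ι → ℝ))‖
      ≤ ∑ μ, (|Y μ| + K) / Δ := by
  refine norm_sum_le_of_le _ fun μ _ => ?_
  rw [norm_smul]
  exact (mul_le_of_le_one_right (norm_nonneg _) (norm_proj_le_one μ)).trans (hf.abs_score_le hΔ _ _)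

variable [IsProbabilityMeasure PA]

lemma abs_logLik_le (hf : ReadoutBound f K) (hΔ : 0 < Δ) (Y s : ι → ℝ) :
    |logLik PA f Δ Y s|
      ≤ ∑ μ, (|Real.log (1 / √(2 * Real.pi * Δ))| + (|Y μ| + K) ^ 2 / (2 * Δ)) :=
  (Finset.abs_sum_le_sum_abs _ _).trans
    (Finset.sum_le_sum fun _ _ => hf.abs_logPout_le hΔ _ _)

lemma integrable_exp_logLik [IsFiniteMeasure π] (hf : ReadoutBound f K) (hΔ : 0 < Δ) (Y : ι → ℝ)
    {s : Θ → ι → ℝ} (hs : Measurable s) :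
    Integrable (fun θ => Real.exp (logLik PA f Δ Y (s θ))) π :=
  integrable_exp_of_abs_le (hf.measurable_logLik measurable_const hs).aemeasurable
    (.of_forall fun _ => hf.abs_logLik_le hΔ _ _)

lemma hasFDerivAt_logLik (hf : ReadoutBound f K) (hΔ : 0 < Δ) (Y s : ι → ℝ) :
    HasFDerivAt (fun Y => logLik PA f Δ Y s)
      (∑ μ, score PA f Δ (Y μ) (s μ) • (.proj μ : StrongDual ℝ (ι → ℝ))) Y :=
  HasFDerivAt.fun_sum fun μ _ => (hf.hasDerivAt_logPout hΔ (Y μ) (s μ)).comp_hasFDerivAt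
    (f := fun Y : ι → ℝ => Y μ) Y (hasFDerivAt_apply μ Y)

lemma integral_sum_score_smul_proj [IsFiniteMeasure π] (hf : ReadoutBound f K) (hΔ : 0 < Δ)
    (Y : ι → ℝ) {s : Θ → ι → ℝ} (hs : Measurable s) :
    ∫ θ, ∑ μ, score PA f Δ (Y μ) (s θ μ) • (.proj μ : StrongDual ℝ (ι → ℝ))
        ∂(π.tilted fun θ => logLik PA f Δ Y (s θ))
      = ∑ μ, meanScore π PA f Δ s Y μ • (.proj μ : StrongDual ℝ (ι → ℝ)) := by
  have hscore (μ : ι) : Measurable fun θ => score PA f Δ (Y μ) (s θ μ) :=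
    hf.measurable_score measurable_const (by fun_prop)
  rw [integral_finsetSum _ fun μ _ => Integrable.smul_const (.of_bound
    (hscore μ).aestronglyMeasurable _ (.of_forall fun _ => hf.abs_score_le hΔ _ _)) _]
  exact Finset.sum_congr rfl fun μ _ => integral_smul_const _ _

lemma hasFDerivAt_log_integral_exp_logLik [IsFiniteMeasure π] [NeZero π] (hf : ReadoutBound f K)
    (hΔ : 0 < Δ) (Y : ι → ℝ) {s : Θ → ι → ℝ} (hs : Measurable s) :
    HasFDerivAt (fun Y => Real.log (∫ θ, Real.exp (logLik PA f Δ Y (s θ)) ∂π))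
      (∑ μ, meanScore π PA f Δ s Y μ • (.proj μ : StrongDual ℝ (ι → ℝ))) Y := by
  rw [← hf.integral_sum_score_smul_proj hΔ Y hs]
  have hK := hf.nonneg
  refine hasFDerivAt_log_integral_exp (F := fun Y θ => logLik PA f Δ Y (s θ))
    (F' := fun Y θ => ∑ μ, score PA f Δ (Y μ) (s θ μ) • (.proj μ : StrongDual ℝ (ι → ℝ)))
    (bound := fun _ => Real.exp (∑ μ, (|Real.log (1 / √(2 * Real.pi * Δ))|
      + (|Y μ| + 1 + K) ^ 2 / (2 * Δ))) * ∑ μ, (|Y μ| + 1 + K) / Δ)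
    (Metric.ball_mem_nhds Y one_pos)
    (.of_forall fun Y => (hf.measurable_logLik measurable_const hs).aemeasurable)
    (hf.integrable_exp_logLik hΔ Y hs)
    (Finset.aestronglyMeasurable_fun_sum _ fun μ _ =>
      (hf.measurable_score measurable_const (by fun_prop)).aestronglyMeasurable.smul_const _)
    (.of_forall fun θ Y' hY' => ?_)
    (integrable_const _) (.of_forall fun θ Y' _ => hf.hasFDerivAt_logLik hΔ Y' (s θ))
  have habs (μ : ι) : |Y' μ| ≤ |Y μ| + 1 := by
    linarith [abs_sub_abs_le_abs_sub (Y' μ) (Y μ), dist_le_pi_dist Y' Y μ,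
      Real.dist_eq (Y' μ) (Y μ), (Metric.mem_ball.1 hY').le]
  rw [norm_smul, Real.norm_eq_abs, Real.abs_exp]
  refine mul_le_mul (Real.exp_le_exp.2 ((le_abs_self _).trans ((hf.abs_logLik_le hΔ _ _).trans ?_)))
    ((hf.norm_sum_score_smul_proj_le hΔ _ _).trans ?_) (norm_nonneg _) (Real.exp_nonneg _)
  · gcongr with μ
    exact habs μ
  · gcongr with μ
    exact habs μ

end ReadoutBound

end Posterior

section NoiseMoments

/-- A bound for `|Y| + K` at a response `Y` with label noise `z`, for a readout bounded by `K`. -/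
def responseBound (K Δ z : ℝ) : ℝ := 2 * K + √Δ * |z|

/-- A bound for `|log P_out (Y | s)|` at a response `Y` with label noise `z`. -/
def logNoiseBound (K Δ z : ℝ) : ℝ :=
  |Real.log (1 / √(2 * Real.pi * Δ))| + responseBound K Δ z ^ 2 / (2 * Δ)

/-- A bound for the derivative of the log-partition function in a field of the teacher whose
response has label noise `z`. -/
def sensNoiseBound (K Δ z : ℝ) : ℝ := responseBound K Δ z / Δ * K

lemma measurable_responseBound (K Δ : ℝ) : Measurable (responseBound K Δ) := by
  unfold responseBound
  fun_prop

lemma measurable_logNoiseBound (K Δ : ℝ) : Measurable (logNoiseBound K Δ) :=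
  (((measurable_responseBound K Δ).pow_const 2).div_const _).const_add _

lemma measurable_sensNoiseBound (K Δ : ℝ) : Measurable (sensNoiseBound K Δ) :=
  ((measurable_responseBound K Δ).div_const _).mul_const _

lemma memLp_responseBound (K Δ : ℝ) (q : ℝ≥0) :
    MemLp (responseBound K Δ) q (gaussianReal 0 1) :=
  (memLp_const (2 * K)).add ((memLp_id_gaussianReal q).abs.const_mul √Δ)

lemma memLp_two_logNoiseBound (K Δ : ℝ) : MemLp (logNoiseBound K Δ) 2 (gaussianReal 0 1) := by
  have hsq : MemLp (fun z => responseBound K Δ z ^ 2) 2 (gaussianReal 0 1) := by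
    refine (memLp_two_iff_integrable_sq
      ((measurable_responseBound K Δ).pow_const 2).aestronglyMeasurable).2 ?_
    have := (memLp_responseBound K Δ 4).integrable_norm_pow (p := 4) (by norm_num)
    refine this.congr (.of_forall fun z => ?_)
    simp only [Real.norm_eq_abs]
    rw [← pow_mul, (show Even (2 * 2) by decide).pow_abs]
  have h := (memLp_const |Real.log (1 / √(2 * Real.pi * Δ))|).add (hsq.const_mul (2 * Δ)⁻¹)
  refine (memLp_congr_ae (.of_forall fun z => ?_)).1 h
  simp only [Pi.add_apply, logNoiseBound, div_eq_inv_mul]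

lemma memLp_two_sensNoiseBound (K Δ : ℝ) : MemLp (sensNoiseBound K Δ) 2 (gaussianReal 0 1) := by
  have h := (memLp_responseBound K Δ 2).const_mul (K / Δ)
  refine (memLp_congr_ae (.of_forall fun z => ?_)).1 h
  simp only [sensNoiseBound]
  ring

variable {k : ℕ} (d n : ℕ) (PA : Measure (Fin k → ℝ)) [IsProbabilityMeasure PA]

lemma measurePreserving_noise :
    MeasurePreserving (fun x : Sample d k => x.2.2.2) (sampleLaw d PA) (gaussianReal 0 1) :=
  measurePreserving_snd.comp (measurePreserving_snd.comp measurePreserving_snd)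

lemma measurePreserving_input :
    MeasurePreserving (fun x : Sample d k => x.2.1) (sampleLaw d PA) (gaussVec d) :=
  measurePreserving_fst.comp measurePreserving_snd

lemma measurePreserving_samples_noise (μ : Fin n) :
    MeasurePreserving (fun x : Fin n → Sample d k => (x μ).2.2.2) (samplesLaw d n PA)
      (gaussianReal 0 1) :=
  (measurePreserving_noise d PA).comp (measurePreserving_eval (fun _ => sampleLaw d PA) μ)

lemma measurePreserving_samples_input (μ : Fin n) :
    MeasurePreserving (fun x : Fin n → Sample d k => (x μ).2.1) (samplesLaw d n PA)
      (gaussVec d) :=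
  (measurePreserving_input d PA).comp (measurePreserving_eval (fun _ => sampleLaw d PA) μ)

end NoiseMoments

section Model

variable {d p n k : ℕ} {PA : Measure (Fin k → ℝ)} {f : ℝ → (Fin k → ℝ) → ℝ} {K Δ t : ℝ}
  {φ : ℝ → ℝ} {α : Type*} [MeasurableSpace α]

/-- The fields of the student with parameters `θ` on the inputs `X`. -/
def studentField (φ : ℝ → ℝ) (t : ℝ) (X : Fin n → Fin d → ℝ) (θ : Params d p n) : Fin n → ℝ :=
  fun μ => interpField φ t θ.1 θ.2.1 θ.2.2.1 (θ.2.2.2 μ) (X μ)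

/-- The teacher's field on one sample, at the outer weights `a` and the inner weights `w`. -/
def teacherField (φ : ℝ → ℝ) (t : ℝ) (a : Fin p → ℝ) (w : Weights d p) (x : Sample d k) : ℝ :=
  interpField φ t a w.1 w.2 x.1 x.2.1

/-- The teacher's responses on the samples. -/
def teacherResponse (f : ℝ → (Fin k → ℝ) → ℝ) (Δ : ℝ) (φ : ℝ → ℝ) (t : ℝ) (a : Fin p → ℝ)
    (w : Weights d p) (x : Fin n → Sample d k) : Fin n → ℝ :=
  fun μ => f (teacherField φ t a w (x μ)) (x μ).2.2.1 + √Δ * (x μ).2.2.2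

/-- The log-partition function, as a function of the teacher's weights and of the samples. -/
def logPartition (PA : Measure (Fin k → ℝ)) (f : ℝ → (Fin k → ℝ) → ℝ) (Δ : ℝ) (φ : ℝ → ℝ) (t : ℝ)
    (a : Fin p → ℝ) (w : Weights d p) (x : Fin n → Sample d k) : ℝ :=
  Real.log (∫ θ, Real.exp (logLik PA f Δ (teacherResponse f Δ φ t a w x)
    (studentField φ t (fun μ => (x μ).2.1) θ)) ∂(prior d p n))

lemma freeEntropy_toDisorder (a : Fin p → ℝ) (q : Weights d p × (Fin n → Sample d k)) :
    freeEntropy PA f Δ φ t a (toDisorder q) = 1 / (n : ℝ) * logPartition PA f Δ φ t a q.1 q.2 :=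
  rfl

lemma measurable_interpField (hφ : Measurable φ) {a : α → Fin p → ℝ} {W : α → Fin p → Fin d → ℝ}
    {v : α → Fin d → ℝ} {ξ : α → ℝ} {x : α → Fin d → ℝ} (ha : Measurable a) (hW : Measurable W)
    (hv : Measurable v) (hξ : Measurable ξ) (hx : Measurable x) :
    Measurable fun q => interpField φ t (a q) (W q) (v q) (ξ q) (x q) := by
  unfold interpField
  fun_prop

lemma measurable_studentField (hφ : Measurable φ) {X : α → Fin n → Fin d → ℝ}
    {θ : α → Params d p n} (hX : Measurable X) (hθ : Measurable θ) :
    Measurable fun q => studentField φ t (X q) (θ q) :=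
  measurable_pi_lambda _ fun _ => measurable_interpField hφ (by fun_prop) (by fun_prop)
    (by fun_prop) (by fun_prop) (by fun_prop)

lemma measurable_teacherField (hφ : Measurable φ) {a : α → Fin p → ℝ} {w : α → Weights d p}
    {x : α → Sample d k} (ha : Measurable a) (hw : Measurable w) (hx : Measurable x) :
    Measurable fun q => teacherField φ t (a q) (w q) (x q) :=
  measurable_interpField hφ ha (by fun_prop) (by fun_prop) (by fun_prop) (by fun_prop)

namespace ReadoutBound

lemma measurable_teacherResponse (hf : ReadoutBound f K) (hφ : Measurable φ) {a : α → Fin p → ℝ}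
    {w : α → Weights d p} {x : α → Fin n → Sample d k} (ha : Measurable a) (hw : Measurable w)
    (hx : Measurable x) : Measurable fun q => teacherResponse f Δ φ t (a q) (w q) (x q) :=
  measurable_pi_lambda _ fun _ => (hf.measurable.comp
    ((measurable_teacherField hφ ha hw (by fun_prop)).prodMk (by fun_prop))).add (by fun_prop)

lemma measurable_logLik_teacherResponse [SFinite PA] (hf : ReadoutBound f K) (hφ : Measurable φ)
    {a : α → Fin p → ℝ} {w : α → Weights d p} {x : α → Fin n → Sample d k} (ha : Measurable a)
    (hw : Measurable w) (hx : Measurable x) :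
    Measurable (Function.uncurry fun q θ => logLik PA f Δ
      (teacherResponse f Δ φ t (a q) (w q) (x q))
      (studentField (p := p) φ t (fun μ => (x q μ).2.1) θ)) :=
  hf.measurable_logLik (hf.measurable_teacherResponse hφ (by fun_prop) (by fun_prop) (by fun_prop))
    (measurable_studentField hφ (by fun_prop) (by fun_prop))

lemma measurable_logPartition [SFinite PA] (hf : ReadoutBound f K) (hφ : Measurable φ)
    {a : α → Fin p → ℝ} {w : α → Weights d p} {x : α → Fin n → Sample d k} (ha : Measurable a)
    (hw : Measurable w) (hx : Measurable x) :
    Measurable fun q => logPartition PA f Δ φ t (a q) (w q) (x q) :=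
  Real.measurable_log.comp (Real.measurable_exp.comp (hf.measurable_logLik_teacherResponse
    hφ ha hw hx)).stronglyMeasurable.integral_prod_right'.measurable

lemma abs_teacherResponse_add_le (hf : ReadoutBound f K) (a : Fin p → ℝ) (w : Weights d p)
    (x : Fin n → Sample d k) (μ : Fin n) :
    |teacherResponse f Δ φ t a w x μ| + K ≤ responseBound K Δ (x μ).2.2.2 := by
  have hsum := abs_add_le (f (teacherField φ t a w (x μ)) (x μ).2.2.1) (√Δ * (x μ).2.2.2)
  have hread := hf.bdd (teacherField φ t a w (x μ)) (x μ).2.2.1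
  rw [abs_mul, abs_of_nonneg (Real.sqrt_nonneg Δ)] at hsum
  unfold teacherResponse responseBound
  linarith

variable [IsProbabilityMeasure PA]

lemma abs_logPout_teacherResponse_le (hf : ReadoutBound f K) (hΔ : 0 < Δ) (a : Fin p → ℝ)
    (w : Weights d p) (x : Fin n → Sample d k) (μ : Fin n) (s : ℝ) :
    |logPout PA f Δ (teacherResponse f Δ φ t a w x μ) s| ≤ logNoiseBound K Δ (x μ).2.2.2 := by
  have hK := hf.nonneg
  refine (hf.abs_logPout_le hΔ _ s).trans ?_
  unfold logNoiseBound
  gcongr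
  exact hf.abs_teacherResponse_add_le a w x μ

lemma abs_logPartition_le (hf : ReadoutBound f K) (hΔ : 0 < Δ) (hφ : Measurable φ)
    (a : Fin p → ℝ) (w : Weights d p) (x : Fin n → Sample d k) :
    |logPartition PA f Δ φ t a w x| ≤ ∑ μ, logNoiseBound K Δ (x μ).2.2.2 :=
  abs_log_integral_exp_le
    (hf.measurable_logLik measurable_const
      (measurable_studentField hφ (by fun_prop) measurable_id)).aemeasurable
    fun _ => (Finset.abs_sum_le_sum_abs _ _).trans (Finset.sum_le_sum fun μ _ =>
      hf.abs_logPout_teacherResponse_le hΔ a w x μ _)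

lemma abs_logPartition_update_sub_le (hf : ReadoutBound f K) (hΔ : 0 < Δ) (hφ : Measurable φ)
    (a : Fin p → ℝ) (w : Weights d p) (x : Fin n → Sample d k) (μ : Fin n) (y : Sample d k) :
    |logPartition PA f Δ φ t a w (Function.update x μ y) - logPartition PA f Δ φ t a w x|
      ≤ logNoiseBound K Δ y.2.2.2 + logNoiseBound K Δ (x μ).2.2.2 := by
  have hint (x : Fin n → Sample d k) := hf.integrable_exp_logLik (PA := PA) (π := prior d p n) hΔ
    (teacherResponse f Δ φ t a w x)
    (measurable_studentField (t := t) (X := fun _ μ => (x μ).2.1) hφ (by fun_prop) measurable_id)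
  refine abs_log_integral_exp_sub_le (hint _) (hint _) fun θ => ?_
  unfold logLik
  rw [← Finset.sum_sub_distrib, Finset.sum_eq_single_of_mem μ (Finset.mem_univ μ)]
  · have hnew := hf.abs_logPout_teacherResponse_le (PA := PA) (φ := φ) (t := t) hΔ a w
      (Function.update x μ y) μ
    rw [Function.update_self] at hnew
    exact (abs_sub _ _).trans
      (add_le_add (hnew _) (hf.abs_logPout_teacherResponse_le hΔ a w x μ _))
  · intro ν _ hν
    simp [teacherResponse, studentField, Function.update_of_ne hν]

lemma memLp_two_logPartition (hf : ReadoutBound f K) (hΔ : 0 < Δ) (hφ : Measurable φ)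
    {P : Measure α} {a : α → Fin p → ℝ} {w : α → Weights d p} {x : α → Fin n → Sample d k}
    (ha : Measurable a) (hw : Measurable w) (hx : MeasurePreserving x P (samplesLaw d n PA)) :
    MemLp (fun q => logPartition PA f Δ φ t (a q) (w q) (x q)) 2 P := by
  have hbound : MemLp (fun q => ∑ μ, logNoiseBound K Δ (x q μ).2.2.2) 2 P :=
    memLp_finsetSum _ fun μ _ => (memLp_two_logNoiseBound K Δ).comp_measurePreserving
      ((measurePreserving_samples_noise d n PA μ).comp hx)
  exact hbound.mono' (hf.measurable_logPartition hφ ha hw hx.measurable).aestronglyMeasurable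
    (.of_forall fun q => hf.abs_logPartition_le hΔ hφ (a q) (w q) (x q))

lemma variance_samples_logPartition_le (hf : ReadoutBound f K) (hΔ : 0 < Δ) (hφ : Measurable φ)
    (a : Fin p → ℝ) (w : Weights d p) :
    Var[logPartition PA f Δ φ t a w; samplesLaw d n PA]
      ≤ 2 * n * ∫ z, logNoiseBound K Δ z ^ 2 ∂(gaussianReal 0 1) := by
  refine (variance_pi_le_of_abs_update_sub_le (α := fun _ => Sample d k)
    (b := fun _ x => logNoiseBound K Δ x.2.2.2)
    (hf.memLp_two_logPartition hΔ hφ measurable_const measurable_const (.id _))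
    (fun _ => (memLp_two_logNoiseBound K Δ).comp_measurePreserving (measurePreserving_noise d PA))
    fun μ x y => hf.abs_logPartition_update_sub_le hΔ hφ a w x μ y).trans_eq ?_
  rw [← (measurePreserving_noise d PA).map_eq, integral_map
    (measurePreserving_noise d PA).aemeasurable
    ((measurable_logNoiseBound K Δ).pow_const 2).aestronglyMeasurable]
  simp [mul_assoc]

end ReadoutBound

end Model

section FieldDerivative

variable {d p : ℕ} {L t : ℝ} {φ : ℝ → ℝ}

/-- The linear form `u ↦ u · X / √d` on weight vectors, as a function of the input `X`. -/
def inputDual (d : ℕ) : (Fin d → ℝ) →L[ℝ] StrongDual ℝ (Fin d → ℝ) :=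
  ∑ j, (ContinuousLinearMap.proj j).smulRight ((√d)⁻¹ • .proj j)

lemma inputDual_apply (X u : Fin d → ℝ) : inputDual d X u = (∑ j, u j * X j) / √d := by
  simp only [inputDual, sum_apply, ContinuousLinearMap.smulRight_apply, smul_apply,
    ContinuousLinearMap.proj_apply, smul_eq_mul, Finset.sum_div]
  exact Finset.sum_congr rfl fun j _ => by ring

lemma inputDual_single (X : Fin d → ℝ) (j : Fin d) :
    inputDual d X (Pi.single j 1) = X j / √d := by
  simp [inputDual_apply, Pi.single_apply]

lemma interpField_eq_inputDual (a : Fin p → ℝ) (w : Weights d p) (ξ : ℝ) (X : Fin d → ℝ) :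
    interpField φ t a w.1 w.2 ξ X = √(1 - t) / √p * ∑ i, a i * φ (inputDual d X (w.1 i))
      + √t * rho φ * inputDual d X w.2 + √(t * eps φ) * ξ := by
  simp only [interpField, inputDual_apply]
  ring

/-- The derivative of `interpField` in the inner weights. -/
def fieldDeriv (φ : ℝ → ℝ) (t : ℝ) (a : Fin p → ℝ) (w : Weights d p) (X : Fin d → ℝ) :
    StrongDual ℝ (Weights d p) :=
  (√(1 - t) / √p) • ∑ i, (a i * deriv φ (inputDual d X (w.1 i))) •
      (inputDual d X ∘L .proj i ∘L .fst ℝ _ _)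
    + (√t * rho φ) • (inputDual d X ∘L .snd ℝ _ _)

lemma hasFDerivAt_interpField (hφ : Differentiable ℝ φ) (a : Fin p → ℝ) (w : Weights d p) (ξ : ℝ)
    (X : Fin d → ℝ) :
    HasFDerivAt (fun w : Weights d p => interpField φ t a w.1 w.2 ξ X) (fieldDeriv φ t a w X)
      w := by
  simp only [interpField_eq_inputDual]
  let preactivation (i : Fin p) : StrongDual ℝ (Weights d p) :=
    inputDual d X ∘L .proj i ∘L .fst ℝ _ _
  have hhidden (i : Fin p) : HasFDerivAt (fun w : Weights d p => φ (inputDual d X (w.1 i)))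
      (deriv φ (inputDual d X (w.1 i)) • preactivation i) w :=
    (hφ _).hasDerivAt.comp_hasFDerivAt w (preactivation i).hasFDerivAt
  have hlinear : HasFDerivAt (fun w : Weights d p => inputDual d X w.2)
      (inputDual d X ∘L .snd ℝ _ _) w := (inputDual d X).hasFDerivAt.comp w hasFDerivAt_snd
  refine ((((HasFDerivAt.fun_sum fun i _ => (hhidden i).const_mul (a i)).const_mul _).add
    (hlinear.const_mul _)).add_const _).congr_fderiv ?_
  simp only [fieldDeriv, preactivation, mul_smul]

lemma fieldDeriv_single_hidden (a : Fin p → ℝ) (w : Weights d p) (X : Fin d → ℝ) (i : Fin p)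
    (j : Fin d) :
    fieldDeriv φ t a w X (Pi.single i (Pi.single j 1), 0)
      = √(1 - t) / √p * (a i * deriv φ (inputDual d X (w.1 i))) * (X j / √d) := by
  rw [← inputDual_single X j]
  simp only [fieldDeriv, add_apply, smul_apply, sum_apply, ContinuousLinearMap.comp_apply,
    ContinuousLinearMap.proj_apply, ContinuousLinearMap.coe_fst', ContinuousLinearMap.coe_snd',
    map_zero, smul_eq_mul, mul_zero, add_zero]
  rw [Finset.sum_eq_single_of_mem i (Finset.mem_univ i) fun i' _ hi' => by
    rw [Pi.single_eq_of_ne hi', map_zero, mul_zero], Pi.single_eq_same, mul_assoc _ (a i * _)]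

lemma fieldDeriv_single_linear (a : Fin p → ℝ) (w : Weights d p) (X : Fin d → ℝ) (j : Fin d) :
    fieldDeriv φ t a w X (0, Pi.single j 1) = √t * rho φ * (X j / √d) := by
  simp [fieldDeriv, inputDual_single]

/-- A bound for the norm of `fieldDeriv`, per unit norm of the input, for an activation function
with derivative bounded by `L`. -/
def fieldLipschitz (φ : ℝ → ℝ) (L t : ℝ) (d : ℕ) (a : Fin p → ℝ) : ℝ :=
  (|√(1 - t) / √p| * ∑ i, |a i| * L + |√t * rho φ|) * ‖inputDual d‖

lemma norm_fieldDeriv_le (hL : ∀ s, |deriv φ s| ≤ L) (a : Fin p → ℝ) (w : Weights d p)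
    (X : Fin d → ℝ) : ‖fieldDeriv φ t a w X‖ ≤ fieldLipschitz φ L t d a * ‖X‖ := by
  have hhidden (i : Fin p) : ‖(a i * deriv φ (inputDual d X (w.1 i))) •
      (inputDual d X ∘L .proj i ∘L .fst ℝ (Fin p → Fin d → ℝ) (Fin d → ℝ))‖
      ≤ |a i| * L * ‖inputDual d X‖ := by
    rw [norm_smul, Real.norm_eq_abs, abs_mul]
    have hL0 := (abs_nonneg _).trans (hL 0)
    gcongr
    · exact hL _
    · exact (ContinuousLinearMap.opNorm_comp_le _ _).trans
        (mul_le_of_le_one_right (norm_nonneg _) ((ContinuousLinearMap.opNorm_comp_le _ _).trans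
          (mul_le_one₀ (norm_proj_le_one i) (norm_nonneg _)
            (ContinuousLinearMap.norm_fst_le ℝ _ _))))
  have hlinear : ‖inputDual d X ∘L .snd ℝ (Fin p → Fin d → ℝ) (Fin d → ℝ)‖ ≤ ‖inputDual d X‖ :=
    (ContinuousLinearMap.opNorm_comp_le _ _).trans
      (mul_le_of_le_one_right (norm_nonneg _) (ContinuousLinearMap.norm_snd_le ℝ _ _))
  have hL0 := (abs_nonneg _).trans (hL 0)
  calc ‖fieldDeriv φ t a w X‖
      ≤ |√(1 - t) / √p| * ∑ i, |a i| * L * ‖inputDual d X‖ + |√t * rho φ| * ‖inputDual d X‖ := by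
        refine (norm_add_le _ _).trans ?_
        rw [norm_smul, norm_smul, Real.norm_eq_abs, Real.norm_eq_abs]
        gcongr
        exact norm_sum_le_of_le _ fun i _ => hhidden i
    _ = (|√(1 - t) / √p| * ∑ i, |a i| * L + |√t * rho φ|) * ‖inputDual d X‖ := by
        rw [← Finset.sum_mul]
        ring
    _ ≤ fieldLipschitz φ L t d a * ‖X‖ := by
        rw [fieldLipschitz, mul_assoc]
        gcongr
        exact (inputDual d).le_opNorm X

lemma measurable_fieldDeriv (a : Fin p → ℝ) (w : Weights d p) :
    Measurable (fieldDeriv φ t a w) := by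
  have hcomp (B : Weights d p →L[ℝ] Fin d → ℝ) : Measurable fun X => inputDual d X ∘L B :=
    Continuous.measurable (by fun_prop)
  have hφ' (i : Fin p) : Measurable fun X => a i * deriv φ (inputDual d X (w.1 i)) :=
    ((measurable_deriv φ).comp (f := fun X => inputDual d X (w.1 i))
      (Continuous.measurable (by fun_prop))).const_mul _
  have hsum := Finset.measurable_fun_sum Finset.univ fun i _ => (hφ' i).smul
    (hcomp (.proj i ∘L .fst ℝ _ _))
  exact (hsum.const_smul (√(1 - t) / √p)).add ((hcomp (.snd ℝ _ _)).const_smul (√t * rho φ))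

lemma memLp_two_fieldDeriv_apply (hL : ∀ s, |deriv φ s| ≤ L) (a : Fin p → ℝ)
    (w v : Weights d p) : MemLp (fun X => fieldDeriv φ t a w X v) 2 (gaussVec d) := by
  have hnorm : MemLp (fun X : Fin d → ℝ => ‖X‖) 2 (gaussVec d) := IsGaussian.memLp_two_id.norm
  refine (hnorm.const_mul (fieldLipschitz φ L t d a * ‖v‖)).mono'
    ((ContinuousLinearMap.apply ℝ ℝ v).continuous.measurable.comp
      (measurable_fieldDeriv a w)).aestronglyMeasurable (.of_forall fun X => ?_)
  rw [mul_right_comm]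
  exact (ContinuousLinearMap.le_opNorm _ v).trans
    (mul_le_mul_of_nonneg_right (norm_fieldDeriv_le hL a w X) (norm_nonneg v))

end FieldDerivative

section WeightDerivative

variable {d p n k : ℕ} {PA : Measure (Fin k → ℝ)} {f : ℝ → (Fin k → ℝ) → ℝ} {K Δ L t : ℝ}
  {φ : ℝ → ℝ}

/-- The derivative of the log-partition function in the `μ`-th field of the teacher. -/
def sensitivity (PA : Measure (Fin k → ℝ)) (f : ℝ → (Fin k → ℝ) → ℝ) (Δ : ℝ) (φ : ℝ → ℝ) (t : ℝ)
    (a : Fin p → ℝ) (w : Weights d p) (x : Fin n → Sample d k) (μ : Fin n) : ℝ :=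
  meanScore (prior d p n) PA f Δ (studentField φ t fun μ => (x μ).2.1)
      (teacherResponse f Δ φ t a w x) μ *
    deriv (fun s => f s (x μ).2.2.1) (teacherField φ t a w (x μ))

/-- The derivative of the log-partition function in the inner weights. -/
def logPartitionDeriv (PA : Measure (Fin k → ℝ)) (f : ℝ → (Fin k → ℝ) → ℝ) (Δ : ℝ) (φ : ℝ → ℝ)
    (t : ℝ) (a : Fin p → ℝ) (w : Weights d p) (x : Fin n → Sample d k) :
    StrongDual ℝ (Weights d p) :=
  ∑ μ, sensitivity PA f Δ φ t a w x μ • fieldDeriv φ t a w (x μ).2.1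

/-- A bound for the norm of `logPartitionDeriv`, in units of `fieldLipschitz`. -/
def derivBound (K Δ : ℝ) (x : Fin n → Sample d k) : ℝ :=
  ∑ μ, sensNoiseBound K Δ (x μ).2.2.2 * ‖(x μ).2.1‖

/-- The log-partition function averaged over the samples. -/
def meanLogPartition (n : ℕ) (PA : Measure (Fin k → ℝ)) (f : ℝ → (Fin k → ℝ) → ℝ) (Δ : ℝ)
    (φ : ℝ → ℝ) (t : ℝ) (a : Fin p → ℝ) (w : Weights d p) : ℝ :=
  ∫ x, logPartition PA f Δ φ t a w x ∂(samplesLaw d n PA)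

lemma integrable_derivBound [IsProbabilityMeasure PA] :
    Integrable (derivBound (d := d) (n := n) K Δ) (samplesLaw d n PA) := by
  refine integrable_finsetSum _ fun μ _ => MemLp.integrable_mul (p := 2) (q := 2) ?_ ?_
  · exact (memLp_two_sensNoiseBound K Δ).comp_measurePreserving
      (measurePreserving_samples_noise d n PA μ)
  · have hnorm : MemLp (fun X => ‖X‖) 2 (gaussVec d) := IsGaussian.memLp_two_id.norm
    exact hnorm.comp_measurePreserving (measurePreserving_samples_input d n PA μ)

namespace ReadoutBound

lemma abs_sensitivity_le (hf : ReadoutBound f K) (hΔ : 0 < Δ) (a : Fin p → ℝ) (w : Weights d p)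
    (x : Fin n → Sample d k) (μ : Fin n) :
    |sensitivity PA f Δ φ t a w x μ| ≤ sensNoiseBound K Δ (x μ).2.2.2 := by
  have hK := hf.nonneg
  rw [sensitivity, sensNoiseBound, abs_mul]
  refine mul_le_mul ((hf.abs_meanScore_le hΔ _ _ μ).trans ?_) (hf.bdd_deriv _ _) (abs_nonneg _)
    (by unfold responseBound; positivity)
  exact div_le_div_of_nonneg_right (hf.abs_teacherResponse_add_le a w x μ) hΔ.le

lemma measurable_sensitivity [SFinite PA] (hf : ReadoutBound f K) (hφ : Measurable φ)
    (a : Fin p → ℝ) (w : Weights d p) (μ : Fin n) :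
    Measurable fun x : Fin n → Sample d k => sensitivity PA f Δ φ t a w x μ := by
  have hresponse : Measurable fun x : Fin n → Sample d k => teacherResponse f Δ φ t a w x :=
    hf.measurable_teacherResponse hφ measurable_const measurable_const measurable_id
  have hstudent : Measurable fun q : (Fin n → Sample d k) × Params d p n =>
      studentField φ t (fun μ => (q.1 μ).2.1) q.2 :=
    measurable_studentField hφ (by fun_prop) measurable_snd
  have hscore : Measurable (Function.uncurry fun (x : Fin n → Sample d k) (θ : Params d p n) =>
      score PA f Δ (teacherResponse f Δ φ t a w x μ)
        (studentField φ t (fun μ => (x μ).2.1) θ μ)) :=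
    hf.measurable_score (y := fun q : (Fin n → Sample d k) × Params d p n =>
        teacherResponse f Δ φ t a w q.1 μ) (by fun_prop)
      ((measurable_pi_apply μ).comp hstudent)
  have hfield : Measurable fun x : Fin n → Sample d k => teacherField φ t a w (x μ) :=
    measurable_teacherField hφ measurable_const measurable_const (measurable_pi_apply μ)
  exact (measurable_integral_tilted (hf.measurable_logLik_teacherResponse hφ measurable_const
    measurable_const measurable_id) hscore).mul
    (hf.measurable_deriv.comp (hfield.prodMk (by fun_prop)))

lemma memLp_two_sensitivity [IsProbabilityMeasure PA] (hf : ReadoutBound f K) (hΔ : 0 < Δ)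
    (hφ : Measurable φ) (a : Fin p → ℝ) (w : Weights d p) (μ : Fin n) :
    MemLp (fun x => sensitivity PA f Δ φ t a w x μ) 2 (samplesLaw d n PA) :=
  ((memLp_two_sensNoiseBound K Δ).comp_measurePreserving
    (measurePreserving_samples_noise d n PA μ)).mono'
    (hf.measurable_sensitivity hφ a w μ).aestronglyMeasurable
    (.of_forall fun x => hf.abs_sensitivity_le hΔ a w x μ)

lemma measurable_logPartitionDeriv [SFinite PA] (hf : ReadoutBound f K) (hφ : Measurable φ)
    (a : Fin p → ℝ) (w : Weights d p) :
    Measurable fun x : Fin n → Sample d k => logPartitionDeriv PA f Δ φ t a w x :=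
  Finset.measurable_fun_sum _ fun μ _ => (hf.measurable_sensitivity hφ a w μ).smul
    ((measurable_fieldDeriv a w).comp (f := fun x : Fin n → Sample d k => (x μ).2.1)
      (by fun_prop))

lemma norm_logPartitionDeriv_le (hf : ReadoutBound f K) (hΔ : 0 < Δ)
    (hL : ∀ s, |deriv φ s| ≤ L) (a : Fin p → ℝ) (w : Weights d p) (x : Fin n → Sample d k) :
    ‖logPartitionDeriv PA f Δ φ t a w x‖ ≤ fieldLipschitz φ L t d a * derivBound K Δ x := by
  rw [derivBound, Finset.mul_sum]
  refine norm_sum_le_of_le _ fun μ _ => ?_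
  rw [norm_smul, mul_left_comm]
  have hsens := hf.abs_sensitivity_le (PA := PA) (φ := φ) (t := t) hΔ a w x μ
  exact mul_le_mul hsens (norm_fieldDeriv_le hL a w _) (norm_nonneg _)
    ((abs_nonneg _).trans hsens)

variable [IsProbabilityMeasure PA]

lemma hasFDerivAt_logPartition (hf : ReadoutBound f K) (hΔ : 0 < Δ) (hφ : Differentiable ℝ φ)
    (a : Fin p → ℝ) (w : Weights d p) (x : Fin n → Sample d k) :
    HasFDerivAt (fun w => logPartition PA f Δ φ t a w x) (logPartitionDeriv PA f Δ φ t a w x)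
      w := by
  have hresponse : HasFDerivAt (fun w => teacherResponse f Δ φ t a w x)
      (.pi fun μ => deriv (fun s => f s (x μ).2.2.1) (teacherField φ t a w (x μ)) •
        fieldDeriv φ t a w (x μ).2.1) w :=
    hasFDerivAt_pi.2 fun μ => (((hf.differentiable (x μ).2.2.1 _).hasDerivAt.comp_hasFDerivAt
      (f := fun w => teacherField φ t a w (x μ)) w
      (hasFDerivAt_interpField hφ a w (x μ).1 (x μ).2.1))).add_const _
  have hstudent := measurable_studentField (d := d) (p := p) (n := n) (t := t)
    hφ.continuous.measurable (measurable_const (a := fun μ => (x μ).2.1)) measurable_id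
  refine ((hf.hasFDerivAt_log_integral_exp_logLik hΔ _ hstudent).comp w hresponse).congr_fderiv ?_
  ext v <;> simp [logPartitionDeriv, sensitivity, mul_assoc]

lemma hasFDerivAt_meanLogPartition (hf : ReadoutBound f K) (hΔ : 0 < Δ) (hφ : Differentiable ℝ φ)
    (hL : ∀ s, |deriv φ s| ≤ L) (a : Fin p → ℝ) (w : Weights d p) :
    HasFDerivAt (meanLogPartition n PA f Δ φ t a)
      (∫ x, logPartitionDeriv PA f Δ φ t a w x ∂(samplesLaw d n PA)) w := by
  have hφm := hφ.continuous.measurable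
  have hmem (w : Weights d p) := hf.memLp_two_logPartition (t := t) hΔ hφm
    (measurable_const (a := a)) (measurable_const (a := w)) (.id (samplesLaw d n PA))
  exact hasFDerivAt_integral_of_dominated_of_fderiv_le Filter.univ_mem
    (.of_forall fun w => (hmem w).aestronglyMeasurable) ((hmem w).integrable one_le_two)
    (hf.measurable_logPartitionDeriv hφm a w).aestronglyMeasurable
    (.of_forall fun x w _ => hf.norm_logPartitionDeriv_le hΔ hL a w x)
    (integrable_derivBound.const_mul _)
    (.of_forall fun x w _ => hf.hasFDerivAt_logPartition hΔ hφ a w x)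

lemma norm_fderiv_meanLogPartition_le (hf : ReadoutBound f K) (hΔ : 0 < Δ)
    (hφ : Differentiable ℝ φ) (hL : ∀ s, |deriv φ s| ≤ L) (a : Fin p → ℝ) (w : Weights d p) :
    ‖fderiv ℝ (meanLogPartition n PA f Δ φ t a) w‖
      ≤ fieldLipschitz φ L t d a * ∫ x : Fin n → Sample d k, derivBound K Δ x
        ∂(samplesLaw d n PA) := by
  rw [(hf.hasFDerivAt_meanLogPartition hΔ hφ hL a w).fderiv, ← integral_const_mul]
  exact norm_integral_le_of_norm_le (integrable_derivBound.const_mul _)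
    (.of_forall fun x => hf.norm_logPartitionDeriv_le hΔ hL a w x)

lemma fderiv_meanLogPartition_apply (hf : ReadoutBound f K) (hΔ : 0 < Δ)
    (hφ : Differentiable ℝ φ) (hL : ∀ s, |deriv φ s| ≤ L) (a : Fin p → ℝ) (w v : Weights d p) :
    fderiv ℝ (meanLogPartition n PA f Δ φ t a) w v
      = ∑ μ, ∫ x, sensitivity PA f Δ φ t a w x μ * fieldDeriv φ t a w (x μ).2.1 v
        ∂(samplesLaw d n PA) := by
  have hderiv : Integrable (logPartitionDeriv PA f Δ φ t a w) (samplesLaw d n PA) :=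
    (integrable_derivBound.const_mul _).mono'
      (hf.measurable_logPartitionDeriv hφ.continuous.measurable a w).aestronglyMeasurable
      (.of_forall fun x => hf.norm_logPartitionDeriv_le hΔ hL a w x)
  rw [(hf.hasFDerivAt_meanLogPartition hΔ hφ hL a w).fderiv,
    ContinuousLinearMap.integral_apply hderiv]
  simp only [logPartitionDeriv, sum_apply, smul_apply, smul_eq_mul]
  exact integral_finsetSum _ fun μ _ => MemLp.integrable_mul (p := 2) (q := 2)
    (hf.memLp_two_sensitivity hΔ hφ.continuous.measurable a w μ)
    ((memLp_two_fieldDeriv_apply hL a w v).comp_measurePreserving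
      (measurePreserving_samples_input d n PA μ))

end ReadoutBound

end WeightDerivative

section GradientBound

variable {d p n k : ℕ} {PA : Measure (Fin k → ℝ)} [IsProbabilityMeasure PA]
  {f : ℝ → (Fin k → ℝ) → ℝ} {K Δ L t : ℝ} {φ : ℝ → ℝ}

/-- Bessel's inequality: the coordinates of one input are orthonormal, so summing the squared
correlations over the `d` coordinates costs no factor `d`. -/
lemma sum_sq_integral_mul_input_le {q : (Fin n → Sample d k) → ℝ}
    (hq : MemLp q 2 (samplesLaw d n PA)) (μ : Fin n) :
    ∑ j, (∫ x, q x * (x μ).2.1 j ∂(samplesLaw d n PA)) ^ 2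
      ≤ ∫ x, q x ^ 2 ∂(samplesLaw d n PA) := by
  have hinput := measurePreserving_samples_input d n PA μ
  refine sum_sq_integral_mul_le_of_forall_integral_sq_le hq
    (fun j => (memLp_two_eval_gaussVec j).comp_measurePreserving hinput) fun c => ?_
  rw [← integral_sq_sum_mul_gaussVec c, ← hinput.map_eq,
    integral_map hinput.aemeasurable (Continuous.aestronglyMeasurable (by fun_prop))]

lemma sum_sq_sum_integral_mul_input_le {q : Fin n → (Fin n → Sample d k) → ℝ} {B : ℝ}
    (hq : ∀ μ, MemLp (q μ) 2 (samplesLaw d n PA))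
    (hB : ∀ μ, ∫ x, q μ x ^ 2 ∂(samplesLaw d n PA) ≤ B) :
    ∑ j, (∑ μ, ∫ x, q μ x * (x μ).2.1 j ∂(samplesLaw d n PA)) ^ 2 ≤ n ^ 2 * B :=
  calc ∑ j, (∑ μ, ∫ x, q μ x * (x μ).2.1 j ∂(samplesLaw d n PA)) ^ 2
      ≤ ∑ j, n * ∑ μ, (∫ x, q μ x * (x μ).2.1 j ∂(samplesLaw d n PA)) ^ 2 :=
        Finset.sum_le_sum fun j _ => by
          simpa using sq_sum_le_card_mul_sum_sq (s := Finset.univ)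
            (f := fun μ => ∫ x, q μ x * (x μ).2.1 j ∂(samplesLaw d n PA))
    _ = n * ∑ μ, ∑ j, (∫ x, q μ x * (x μ).2.1 j ∂(samplesLaw d n PA)) ^ 2 := by
        rw [← Finset.mul_sum, Finset.sum_comm]
    _ ≤ n * ∑ _ : Fin n, B := by
        gcongr with μ
        exact (sum_sq_integral_mul_input_le (hq μ) μ).trans (hB μ)
    _ = n ^ 2 * B := by
        simp [sq, mul_assoc]

namespace ReadoutBound

lemma integral_sq_mul_sensitivity_le (hf : ReadoutBound f K) (hΔ : 0 < Δ)
    (a : Fin p → ℝ) (w : Weights d p) {c : (Fin d → ℝ) → ℝ} {B : ℝ} (hB : ∀ X, |c X| ≤ B)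
    (μ : Fin n) :
    ∫ x, (c (x μ).2.1 * sensitivity PA f Δ φ t a w x μ) ^ 2 ∂(samplesLaw d n PA)
      ≤ B ^ 2 * ∫ z, sensNoiseBound K Δ z ^ 2 ∂(gaussianReal 0 1) := by
  have hnoise := measurePreserving_samples_noise d n PA μ
  rw [← hnoise.map_eq, integral_map hnoise.aemeasurable
    ((measurable_sensNoiseBound K Δ).pow_const 2).aestronglyMeasurable, ← integral_const_mul]
  refine integral_mono_of_nonneg (.of_forall fun x => sq_nonneg _)
    (((memLp_two_sensNoiseBound K Δ).comp_measurePreserving hnoise).integrable_sq.const_mul _)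
    (.of_forall fun x => ?_)
  beta_reduce
  rw [← mul_pow, ← sq_abs, abs_mul]
  gcongr
  · exact (abs_nonneg _).trans (hB 0)
  · exact hB _
  · exact hf.abs_sensitivity_le hΔ a w x μ

lemma sum_sq_integral_sensitivity_mul_input_le (hf : ReadoutBound f K) (hΔ : 0 < Δ)
    (hφ : Measurable φ) (a : Fin p → ℝ) (w : Weights d p) {c : (Fin d → ℝ) → ℝ}
    (hc : Measurable c) {B : ℝ} (hB : ∀ X, |c X| ≤ B) :
    ∑ j, (∑ μ, ∫ x, sensitivity PA f Δ φ t a w x μ * (c (x μ).2.1 * ((x μ).2.1 j / √d))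
        ∂(samplesLaw d n PA)) ^ 2
      ≤ n ^ 2 / d * (B ^ 2 * ∫ z, sensNoiseBound K Δ z ^ 2 ∂(gaussianReal 0 1)) := by
  have hmem (μ : Fin n) : MemLp (fun x => c (x μ).2.1 * sensitivity PA f Δ φ t a w x μ) 2
      (samplesLaw d n PA) :=
    (hf.memLp_two_sensitivity hΔ hφ a w μ).mul' (memLp_top_of_bound
      (hc.comp (f := fun x : Fin n → Sample d k => (x μ).2.1) (by fun_prop)).aestronglyMeasurable
      B (.of_forall fun x => hB _))
  have hscale (j : Fin d) :
      ∑ μ, ∫ x, sensitivity PA f Δ φ t a w x μ * (c (x μ).2.1 * ((x μ).2.1 j / √d))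
          ∂(samplesLaw d n PA)
        = (∑ μ, ∫ x, c (x μ).2.1 * sensitivity PA f Δ φ t a w x μ * (x μ).2.1 j
          ∂(samplesLaw d n PA)) / √d := by
    simp only [Finset.sum_div, ← integral_div]
    exact Finset.sum_congr rfl fun μ _ => integral_congr_ae (.of_forall fun x => by ring)
  simp only [hscale, div_pow, Real.sq_sqrt d.cast_nonneg, ← Finset.sum_div]
  rw [div_mul_eq_mul_div]
  gcongr
  exact sum_sq_sum_integral_mul_input_le hmem fun μ =>
    hf.integral_sq_mul_sensitivity_le hΔ a w hB μ

lemma variance_fderiv_meanLogPartition_le (hf : ReadoutBound f K) (hΔ : 0 < Δ)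
    (hφ : Differentiable ℝ φ) (hL : ∀ s, |deriv φ s| ≤ L) (ht : t ∈ Set.Icc (0 : ℝ) 1)
    (a : Fin p → ℝ) (w : Weights d p) :
    Var[fderiv ℝ (meanLogPartition n PA f Δ φ t a) w; weightLaw d p]
      ≤ n ^ 2 / d * ((L ^ 2 * ((∑ i, a i ^ 2) / p) + rho φ ^ 2) *
          ∫ z, sensNoiseBound K Δ z ^ 2 ∂(gaussianReal 0 1)) := by
  set M := ∫ z, sensNoiseBound K Δ z ^ 2 ∂(gaussianReal 0 1)
  have hφm := hφ.continuous.measurable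
  have hhidden (i : Fin p) :
      ∑ j, fderiv ℝ (meanLogPartition n PA f Δ φ t a) w (Pi.single i (Pi.single j 1), 0) ^ 2
        ≤ n ^ 2 / d * ((√(1 - t) / √p * (|a i| * L)) ^ 2 * M) := by
    simp only [hf.fderiv_meanLogPartition_apply hΔ hφ hL, fieldDeriv_single_hidden]
    refine hf.sum_sq_integral_sensitivity_mul_input_le hΔ hφm a w
      (c := fun X => √(1 - t) / √p * (a i * deriv φ (inputDual d X (w.1 i))))
      ((((_root_.measurable_deriv φ).comp
        (Continuous.measurable (by fun_prop))).const_mul _).const_mul _) fun X => ?_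
    rw [abs_mul, abs_mul, abs_of_nonneg (by positivity : 0 ≤ √(1 - t) / √p)]
    gcongr
    exact hL _
  have hlinear :
      ∑ j, fderiv ℝ (meanLogPartition n PA f Δ φ t a) w (0, Pi.single j 1) ^ 2
        ≤ n ^ 2 / d * ((√t * rho φ) ^ 2 * M) := by
    simp only [hf.fderiv_meanLogPartition_apply hΔ hφ hL, fieldDeriv_single_linear]
    rw [← sq_abs (√t * rho φ)]
    exact hf.sum_sq_integral_sensitivity_mul_input_le hΔ hφm a w measurable_const fun _ => le_rfl
  have hM : 0 ≤ M := integral_nonneg fun z => sq_nonneg _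
  calc Var[fderiv ℝ (meanLogPartition n PA f Δ φ t a) w; weightLaw d p]
      ≤ ∑ i, n ^ 2 / d * ((√(1 - t) / √p * (|a i| * L)) ^ 2 * M)
        + n ^ 2 / d * ((√t * rho φ) ^ 2 * M) := by
        rw [variance_dual_weightLaw]
        exact add_le_add (Finset.sum_le_sum fun i _ => hhidden i) hlinear
    _ = n ^ 2 / d * (((1 - t) * (L ^ 2 * ((∑ i, a i ^ 2) / p)) + t * rho φ ^ 2) * M) := by
        simp only [mul_pow, div_pow, Real.sq_sqrt ht.1, Real.sq_sqrt (sub_nonneg.2 ht.2),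
          Real.sq_sqrt p.cast_nonneg, sq_abs, ← Finset.mul_sum, ← Finset.sum_mul]
        ring
    _ ≤ n ^ 2 / d * ((L ^ 2 * ((∑ i, a i ^ 2) / p) + rho φ ^ 2) * M) := by
        have hsum : 0 ≤ (∑ i, a i ^ 2) / p :=
          div_nonneg (Finset.sum_nonneg fun i _ => sq_nonneg (a i)) p.cast_nonneg
        have hhidden := mul_le_of_le_one_left (mul_nonneg (sq_nonneg L) hsum) (sub_le_self 1 ht.1)
        have hlinear := mul_le_of_le_one_left (sq_nonneg (rho φ)) ht.2
        exact mul_le_mul_of_nonneg_left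
          (mul_le_mul_of_nonneg_right (add_le_add hhidden hlinear) hM) (by positivity)

lemma variance_meanLogPartition_le (hf : ReadoutBound f K) (hΔ : 0 < Δ)
    (hφ : Differentiable ℝ φ) (hL : ∀ s, |deriv φ s| ≤ L) (ht : t ∈ Set.Icc (0 : ℝ) 1)
    (a : Fin p → ℝ) :
    Var[meanLogPartition n PA f Δ φ t a; weightLaw d p]
      ≤ Real.pi ^ 2 / 8 * (n ^ 2 / d * ((L ^ 2 * ((∑ i, a i ^ 2) / p) + rho φ ^ 2) *
          ∫ z, sensNoiseBound K Δ z ^ 2 ∂(gaussianReal 0 1))) := by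
  have hdiff : Differentiable ℝ (meanLogPartition (d := d) n PA f Δ φ t a) := fun w =>
    (hf.hasFDerivAt_meanLogPartition hΔ hφ hL a w).differentiableAt
  have hlip := lipschitzWith_of_nnnorm_fderiv_le (C := (fieldLipschitz φ L t d a *
    ∫ x : Fin n → Sample d k, derivBound K Δ x ∂(samplesLaw d n PA)).toNNReal) hdiff fun w =>
    NNReal.le_toNNReal_of_coe_le (hf.norm_fderiv_meanLogPartition_le hΔ hφ hL a w)
  refine (variance_le_integral_variance_fderiv (integral_id_weightLaw d p) hdiff hlip).trans ?_
  gcongr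
  refine (integral_mono_of_nonneg (.of_forall fun w => variance_nonneg _ _) (integrable_const _)
    (.of_forall fun w => hf.variance_fderiv_meanLogPartition_le hΔ hφ hL ht a w)).trans_eq ?_
  simp

end ReadoutBound

end GradientBound

section Concentration

variable {d p n k : ℕ} {PA : Measure (Fin k → ℝ)} [IsProbabilityMeasure PA]
  {f : ℝ → (Fin k → ℝ) → ℝ} {K Δ L t : ℝ} {φ : ℝ → ℝ}

/-- The list of samples contained in the disorder. -/
def toSamples (ω : Disorder d p n k) : Fin n → Sample d k :=
  fun μ => (ω.2.2.1 μ, ω.2.2.2.1 μ, ω.2.2.2.2.1 μ, ω.2.2.2.2.2 μ)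

variable (d p n PA) in
lemma measurePreserving_toSamples :
    MeasurePreserving toSamples (disorderLaw d p n PA) (samplesLaw d n PA) := by
  have hmeas : Measurable (toSamples : Disorder d p n k → Fin n → Sample d k) := by
    unfold toSamples
    fun_prop
  have hregroup := measurePreserving_toDisorder d p n PA
  refine ⟨hmeas, ?_⟩
  rw [← hregroup.map_eq, Measure.map_map hmeas hregroup.measurable]
  exact measurePreserving_snd.map_eq

lemma integral_sum_sq_gaussVec (p : ℕ) : ∫ a, ∑ i, a i ^ 2 ∂(gaussVec p) = p := by
  rw [integral_finsetSum _ fun i _ => (memLp_two_eval_gaussVec i).integrable_sq]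
  have hsq (i : Fin p) : ∫ a : Fin p → ℝ, a i ^ 2 ∂(gaussVec p) = 1 := by
    simpa [Pi.single_apply] using integral_sq_sum_mul_gaussVec (Pi.single i (1 : ℝ))
  simp [hsq]

/-- The constant of the concentration inequality, for a readout bounded by `K` and an activation
function with derivative bounded by `L`. -/
def concentrationConst (K Δ L : ℝ) (φ : ℝ → ℝ) : ℝ :=
  2 * ∫ z, logNoiseBound K Δ z ^ 2 ∂(gaussianReal 0 1)
    + Real.pi ^ 2 / 8 * ((L ^ 2 + rho φ ^ 2) * ∫ z, sensNoiseBound K Δ z ^ 2 ∂(gaussianReal 0 1))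

lemma integral_logNoiseBound_sq_nonneg (K Δ : ℝ) :
    0 ≤ ∫ z, logNoiseBound K Δ z ^ 2 ∂(gaussianReal 0 1) :=
  integral_nonneg fun _ => sq_nonneg _

lemma integral_sensNoiseBound_sq_nonneg (K Δ : ℝ) :
    0 ≤ ∫ z, sensNoiseBound K Δ z ^ 2 ∂(gaussianReal 0 1) :=
  integral_nonneg fun _ => sq_nonneg _

lemma concentrationConst_nonneg (K Δ L : ℝ) (φ : ℝ → ℝ) : 0 ≤ concentrationConst K Δ L φ :=
  add_nonneg (mul_nonneg zero_le_two (integral_logNoiseBound_sq_nonneg K Δ))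
    (mul_nonneg (by positivity)
      (mul_nonneg (by positivity) (integral_sensNoiseBound_sq_nonneg K Δ)))

namespace ReadoutBound

lemma variance_logPartition_le (hf : ReadoutBound f K) (hΔ : 0 < Δ) (hφ : Differentiable ℝ φ)
    (hL : ∀ s, |deriv φ s| ≤ L) (ht : t ∈ Set.Icc (0 : ℝ) 1) (a : Fin p → ℝ) :
    Var[fun q => logPartition PA f Δ φ t a q.1 q.2; (weightLaw d p).prod (samplesLaw d n PA)]
      ≤ 2 * n * ∫ z, logNoiseBound K Δ z ^ 2 ∂(gaussianReal 0 1)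
        + Real.pi ^ 2 / 8 * (n ^ 2 / d * ((L ^ 2 * ((∑ i, a i ^ 2) / p) + rho φ ^ 2) *
          ∫ z, sensNoiseBound K Δ z ^ 2 ∂(gaussianReal 0 1))) := by
  have hφm := hφ.continuous.measurable
  rw [variance_prod_eq (hf.memLp_two_logPartition hΔ hφm measurable_const measurable_fst
    measurePreserving_snd)]
  refine add_le_add ?_ (hf.variance_meanLogPartition_le hΔ hφ hL ht a)
  refine (integral_mono_of_nonneg (.of_forall fun w => variance_nonneg _ _) (integrable_const _)
    (.of_forall fun w => hf.variance_samples_logPartition_le hΔ hφm a w)).trans_eq ?_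
  simp

lemma memLp_two_freeEntropy (hf : ReadoutBound f K) (hΔ : 0 < Δ) (hφ : Measurable φ)
    {α : Type*} [MeasurableSpace α] {P : Measure α} {a : α → Fin p → ℝ} {ω : α → Disorder d p n k}
    (ha : Measurable a) (hω : MeasurePreserving ω P (disorderLaw d p n PA)) :
    MemLp (fun q => freeEntropy PA f Δ φ t (a q) (ω q)) 2 P := by
  have hωm := hω.measurable
  exact (hf.memLp_two_logPartition hΔ hφ ha (w := fun q => ((ω q).1, (ω q).2.1)) (by fun_prop)
    ((measurePreserving_toSamples d p n PA).comp hω)).const_mul (1 / (n : ℝ))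

lemma variance_freeEntropy_le (hf : ReadoutBound f K) (hΔ : 0 < Δ) (hφ : Differentiable ℝ φ)
    (hL : ∀ s, |deriv φ s| ≤ L) (hn : 0 < n) (ht : t ∈ Set.Icc (0 : ℝ) 1) (a : Fin p → ℝ) :
    Var[freeEntropy PA f Δ φ t a; disorderLaw d p n PA]
      ≤ 2 * (∫ z, logNoiseBound K Δ z ^ 2 ∂(gaussianReal 0 1)) * (1 / n)
        + Real.pi ^ 2 / 8 * ((L ^ 2 * ((∑ i, a i ^ 2) / p) + rho φ ^ 2) *
          ∫ z, sensNoiseBound K Δ z ^ 2 ∂(gaussianReal 0 1)) * (1 / d) := by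
  have hmem := hf.memLp_two_freeEntropy (PA := PA) (t := t) hΔ hφ.continuous.measurable
    (measurable_const (a := a)) (.id (disorderLaw d p n PA))
  have hregroup := (measurePreserving_toDisorder d p n PA).variance_fun_comp
    hmem.aestronglyMeasurable.aemeasurable
  simp only [id_eq, freeEntropy_toDisorder, variance_const_mul] at hregroup
  rw [← hregroup]
  refine (mul_le_mul_of_nonneg_left (hf.variance_logPartition_le hΔ hφ hL ht a)
    (sq_nonneg _)).trans_eq ?_
  field_simp

lemma integral_variance_freeEntropy_le (hf : ReadoutBound f K) (hΔ : 0 < Δ)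
    (hφ : Differentiable ℝ φ) (hL : ∀ s, |deriv φ s| ≤ L) (hp : 0 < p) (hn : 0 < n)
    (ht : t ∈ Set.Icc (0 : ℝ) 1) :
    ∫ a, Var[freeEntropy PA f Δ φ t a; disorderLaw d p n PA] ∂(gaussVec p)
      ≤ concentrationConst K Δ L φ * (1 / d + 1 / n) := by
  have hM₁ := integral_logNoiseBound_sq_nonneg K Δ
  have hM₂ := integral_sensNoiseBound_sq_nonneg K Δ
  set M₁ := ∫ z, logNoiseBound K Δ z ^ 2 ∂(gaussianReal 0 1) with hM₁_def
  set M₂ := ∫ z, sensNoiseBound K Δ z ^ 2 ∂(gaussianReal 0 1) with hM₂_def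
  have hsum : Integrable (fun a : Fin p → ℝ => (∑ i, a i ^ 2) / p) (gaussVec p) :=
    (integrable_finsetSum _ fun i _ => (memLp_two_eval_gaussVec i).integrable_sq).div_const _
  have hmean : ∫ a, (∑ i, a i ^ 2) / p ∂(gaussVec p) = 1 := by
    rw [integral_div, integral_sum_sq_gaussVec, div_self (by exact_mod_cast hp.ne')]
  set c₀ := 2 * M₁ * (1 / n) + Real.pi ^ 2 / 8 * (rho φ ^ 2 * M₂) * (1 / d) with hc₀
  set c₁ := Real.pi ^ 2 / 8 * (L ^ 2 * M₂) * (1 / d) with hc₁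
  have hvar (a : Fin p → ℝ) : Var[freeEntropy PA f Δ φ t a; disorderLaw d p n PA]
      ≤ c₀ + c₁ * ((∑ i, a i ^ 2) / p) :=
    (hf.variance_freeEntropy_le hΔ hφ hL hn ht a).trans_eq (by simp only [hc₀, hc₁]; ring)
  calc ∫ a, Var[freeEntropy PA f Δ φ t a; disorderLaw d p n PA] ∂(gaussVec p)
      ≤ ∫ a : Fin p → ℝ, (c₀ + c₁ * ((∑ i, a i ^ 2) / p)) ∂(gaussVec p) :=
        integral_mono_of_nonneg (.of_forall fun a => variance_nonneg _ _)
          ((integrable_const _).add (hsum.const_mul _)) (.of_forall hvar)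
    _ = c₀ + c₁ := by
        rw [integral_add (integrable_const _) (hsum.const_mul _), integral_const_mul, hmean]
        simp
    _ ≤ concentrationConst K Δ L φ * (1 / d + 1 / n) := by
        have hn₁ : 0 ≤ 2 * M₁ * (1 / (d : ℝ)) := by positivity
        have hd₁ : 0 ≤ Real.pi ^ 2 / 8 * ((L ^ 2 + rho φ ^ 2) * M₂) * (1 / (n : ℝ)) := by
          positivity
        simp only [concentrationConst, hc₀, hc₁, ← hM₁_def, ← hM₂_def]
        linarith

end ReadoutBound

end Concentration

section Reduction

variable {k : ℕ} {PA : Measure (Fin k → ℝ)} {f g : ℝ → (Fin k → ℝ) → ℝ}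

lemma exists_readoutBound_ae_eq {K : ℝ} (hf : Measurable (Function.uncurry f))
    (hreg : ∀ᵐ A ∂PA, Differentiable ℝ (fun x => f x A) ∧
      ∀ x, |f x A| ≤ K ∧ |deriv (fun x => f x A) x| ≤ K) :
    ∃ g, ReadoutBound g |K| ∧ ∀ᵐ A ∂PA, ∀ x, f x A = g x A := by
  obtain ⟨T, hTae, hTmeas, hT⟩ := hreg.exists_measurable_mem
  have hin {A : Fin k → ℝ} (hA : A ∈ T) (x : ℝ) : T.indicator (f x) A = f x A :=
    Set.indicator_of_mem hA _
  have hout {A : Fin k → ℝ} (hA : A ∉ T) (x : ℝ) : T.indicator (f x) A = 0 :=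
    Set.indicator_of_notMem hA _
  refine ⟨fun x => T.indicator (f x), ⟨?_, fun A => ?_, fun x A => ?_, fun x A => ?_⟩,
    Filter.mem_of_superset hTae fun A hA x => (hin hA x).symm⟩
  · exact hf.indicator (measurable_snd hTmeas)
  all_goals by_cases hA : A ∈ T
  · simpa only [hin hA] using (hT A hA).1
  · simp only [hout hA, differentiable_const]
  · simpa only [hin hA] using ((hT A hA).2 x).1.trans (le_abs_self K)
  · simp only [hout hA, abs_zero, abs_nonneg]
  · simpa only [hin hA] using ((hT A hA).2 x).2.trans (le_abs_self K)
  · simp only [hout hA, deriv_const, abs_zero, abs_nonneg]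

lemma Pout_congr_ae (h : ∀ᵐ A ∂PA, ∀ x, f x A = g x A) (Δ : ℝ) : Pout PA f Δ = Pout PA g Δ := by
  funext y x
  exact integral_congr_ae (h.mono fun A hA => by simp only [hA x])

lemma freeEntropy_congr_ae [IsProbabilityMeasure PA] (h : ∀ᵐ A ∂PA, ∀ x, f x A = g x A) (Δ : ℝ)
    (φ : ℝ → ℝ) (t : ℝ) (d p n : ℕ) :
    ∀ᵐ ω ∂(disorderLaw d p n PA), ∀ a,
      freeEntropy PA f Δ φ t a ω = freeEntropy PA g Δ φ t a ω := by
  have hreadout (μ : Fin n) :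
      MeasurePreserving (fun ω : Disorder d p n k => ω.2.2.2.2.1 μ) (disorderLaw d p n PA) PA :=
    (measurePreserving_eval (fun _ => PA) μ).comp (measurePreserving_fst.comp
      (measurePreserving_snd.comp (measurePreserving_snd.comp
        (measurePreserving_snd.comp measurePreserving_snd))))
  filter_upwards [ae_all_iff.2 fun μ => (hreadout μ).quasiMeasurePreserving.ae h] with ω hω a
  have hresponse : response f Δ φ t a ω = response g Δ φ t a ω := by
    funext μ
    simp only [response, hω μ]
  simp only [freeEntropy, partitionFn, logPout, hresponse, Pout_congr_ae h]

end Reduction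

end TwoLayer

end

theorem mainTheorem2_general {k : ℕ} (PA : Measure (Fin k → ℝ)) [IsProbabilityMeasure PA]
    (f : ℝ → (Fin k → ℝ) → ℝ) (hf : Measurable (Function.uncurry f)) {K : ℝ}
    (hreg : ∀ᵐ A ∂PA, Differentiable ℝ (fun x => f x A) ∧
      ∀ x, |f x A| ≤ K ∧ |deriv (fun x => f x A) x| ≤ K)
    (φ : ℝ → ℝ) (hφ : Differentiable ℝ φ) {L : ℝ≥0} (hL : LipschitzWith L φ)
    (Δ : ℝ) (hΔ : 0 < Δ) :
    ∃ C : ℝ, 0 ≤ C ∧ ∀ d p n : ℕ, 0 < d → 0 < p → 0 < n → ∀ t ∈ Set.Icc (0 : ℝ) 1,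
      MemLp (fun q : (Fin p → ℝ) × TwoLayer.Disorder d p n k =>
          TwoLayer.freeEntropy PA f Δ φ t q.1 q.2) 2
        ((TwoLayer.gaussVec p).prod (TwoLayer.disorderLaw d p n PA)) ∧
      (∫ a, variance (fun ω : TwoLayer.Disorder d p n k => TwoLayer.freeEntropy PA f Δ φ t a ω)
          (TwoLayer.disorderLaw d p n PA) ∂(TwoLayer.gaussVec p)) =
        (∫ q : (Fin p → ℝ) × TwoLayer.Disorder d p n k,
          (TwoLayer.freeEntropy PA f Δ φ t q.1 q.2 -
            ∫ ω, TwoLayer.freeEntropy PA f Δ φ t q.1 ω ∂(TwoLayer.disorderLaw d p n PA)) ^ 2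
          ∂((TwoLayer.gaussVec p).prod (TwoLayer.disorderLaw d p n PA))) ∧
      (∫ a, variance (fun ω : TwoLayer.Disorder d p n k => TwoLayer.freeEntropy PA f Δ φ t a ω)
          (TwoLayer.disorderLaw d p n PA) ∂(TwoLayer.gaussVec p)) ≤
        C * (1 / (d : ℝ) + 1 / (n : ℝ)) := by
  obtain ⟨g, hg, hfg⟩ := TwoLayer.exists_readoutBound_ae_eq hf hreg
  refine ⟨TwoLayer.concentrationConst |K| Δ L φ, TwoLayer.concentrationConst_nonneg _ _ _ _,
    fun d p n _ hp hn t ht => ?_⟩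
  have hcongr := TwoLayer.freeEntropy_congr_ae hfg Δ φ t d p n
  have hmem : MemLp (fun q : (Fin p → ℝ) × TwoLayer.Disorder d p n k =>
      TwoLayer.freeEntropy PA f Δ φ t q.1 q.2) 2
      ((TwoLayer.gaussVec p).prod (TwoLayer.disorderLaw d p n PA)) := by
    refine (hg.memLp_two_freeEntropy (t := t) hΔ hφ.continuous.measurable measurable_fst
      measurePreserving_snd).ae_eq ?_
    filter_upwards [Measure.quasiMeasurePreserving_snd.ae hcongr] with q hq
    exact (hq q.1).symm
  refine ⟨hmem, TwoLayer.integral_variance_eq_integral_sq_sub hmem, ?_⟩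
  simp only [fun a => variance_congr (hcongr.mono fun _ hω => hω a)]
  exact hg.integral_variance_freeEntropy_le hΔ hφ (fun s => norm_deriv_le_of_lipschitz hL) hp hn ht

theorem mainTheorem2 {k : ℕ} (PA : Measure (Fin k → ℝ)) [IsProbabilityMeasure PA]
    (f : ℝ → (Fin k → ℝ) → ℝ) (hf : TwoLayer.ReadoutRegular PA f)
    (φ : ℝ → ℝ) (hφ : TwoLayer.ActivationRegular φ) (Δ : ℝ) (hΔ : 0 < Δ) :
    ∃ C : ℝ, 0 ≤ C ∧ ∀ d p n : ℕ, 0 < d → 0 < p → 0 < n → ∀ t ∈ Set.Icc (0 : ℝ) 1,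
      MemLp (fun q : (Fin p → ℝ) × TwoLayer.Disorder d p n k =>
          TwoLayer.freeEntropy PA f Δ φ t q.1 q.2) 2
        ((TwoLayer.gaussVec p).prod (TwoLayer.disorderLaw d p n PA)) ∧
      (∫ a, variance (fun ω : TwoLayer.Disorder d p n k => TwoLayer.freeEntropy PA f Δ φ t a ω)
          (TwoLayer.disorderLaw d p n PA) ∂(TwoLayer.gaussVec p)) =
        (∫ q : (Fin p → ℝ) × TwoLayer.Disorder d p n k,
          (TwoLayer.freeEntropy PA f Δ φ t q.1 q.2 -
            ∫ ω, TwoLayer.freeEntropy PA f Δ φ t q.1 ω ∂(TwoLayer.disorderLaw d p n PA)) ^ 2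
          ∂((TwoLayer.gaussVec p).prod (TwoLayer.disorderLaw d p n PA))) ∧
      (∫ a, variance (fun ω : TwoLayer.Disorder d p n k => TwoLayer.freeEntropy PA f Δ φ t a ω)
          (TwoLayer.disorderLaw d p n PA) ∂(TwoLayer.gaussVec p)) ≤
        C * (1 / (d : ℝ) + 1 / (n : ℝ)) := by
  obtain ⟨K, hK⟩ := hf.bdd
  obtain ⟨L, hL⟩ := hφ.lipschitz
  exact mainTheorem2_general PA f hf.measurable
    ((hf.differentiable.and hK).mono fun A hA => ⟨hA.1.1, fun x => ⟨(hA.2 x).1, (hA.2 x).2.1⟩⟩)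
    φ (hφ.contDiff.differentiable (by norm_num)) hL Δ hΔ
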